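/- Let $\mathbb{X}$ be a Banach space over $\mathbb{F}=\mathbb{R}$ or $\mathbb{C}$ and let $\mathcal{X}=(\mathbf{x}_n)_{n\in\mathbb{N}}$ be a basis of $\mathbb{X}$: the linear span of the $\mathbf{x}_n$ is dense, and there are biorthogonal functionals $(\mathbf{x}_n^*)_{n\in\mathbb{N}}\subset\mathbb{X}^*$. Assume that the quantities $$\alpha_1=\sup_n\|\mathbf{x}_n\|,\qquad \alpha_2=\sup_n\|\mathbf{x}_n^*\|,\qquad \alpha_3=\sup_n\|\mathbf{x}_n\|\,\|\mathbf{x}_n^*\|$$ are finite. Let $\operatorname{supp}(x)=\{n:\mathbf{x}_n^*(x)\neq0\}$. A sequence $(k_j)_{j\ge1}$ of indices is a greedy ordering for $x\in\mathbb{X}$ if, for every $m\ge 1$, the set $\{k_1,\dots,k_m\}$ has $m$ elements and $|\mathbf{x}_i^*(x)|\ge|\mathbf{x}_l^*(x)|$ for all $i$ in it and all $l$ outside it; in this case let $C_n(x)=\sum_{j=1}^n\frac{n+1-j}{n}\,\mathbf{x}_{k_j}^*(x)\,\mathbf{x}_{k_j}$. For $K>0$, the basis is $K$-de la Vallée-Poussin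 quasi-greedy ($K$-VPQG) if $\|2C_{2n}(x)-C_n(x)\|\le K\|x\|$ for all $x\in\mathbb{X}$, all $n\ge1$ and all greedy orderings for $x$. It is VPQG if it is $K$-VPQG for some $K>0$. For $0<t\le1$ let $\phi(t)\in[1,\infty]$ be the least $C$ such that $\|\sum_{n\in A}\mathbf{x}_n^*(x)\mathbf{x}_n\|\le C\|x\|$ for all $x\in\mathbb{X}$ with $\sup_n|\mathbf{x}_n^*(x)|\le1$ and all finite $A\subset\{n:|\mathbf{x}_n^*(x)|\ge t\}$. The basis is nearly unconditional if $\phi(t)<\infty$ for all $0<t\le 1$. Write $x\rhd y$ if $|\mathbf{x}_k^*(x)|\ge|\mathbf{x}_n^*(y)|$ for all $k\in\operatorname{supp}(x)$ and $n\in\mathbb{N}$. For $y$ with finite nonempty support let $\operatorname{osc}(y)$ be the ratio of the maximum to the minimum of $|\mathbf{x}_n^*(y)|$ over $n\in\operatorname{supp}(y)$, and set $\operatorname{osc}(y)=1$ if the support is empty. For $t\ge0$ and $0<s\le1$ let $\Psi(t,s)\in[1,\infty]$ be the least $C\in[1,\infty]$ such that $$\Big\|\sum_{j\in\operatorname{supp}(y)}a_j\,\mathbf{x}_j^*(y)\,\mathbf{x}_j\Big\|\le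 C\,\|x+y+z\|$$ whenever $x,y,z\in\mathbb{X}$ have pairwise disjoint supports, $x\rhd y\rhd z$, $y$ has finite support, $|\operatorname{supp}(x)|\le t\,|\operatorname{supp}(y)|$, $\operatorname{osc}(y)\le s^{-1}$, and the scalars $a_j$ satisfy $|a_j|\le1$ for all $j\in\operatorname{supp}(y)$. Lemma. Suppose that $\mathcal{X}$ is VPQG. Then $\mathcal{X}$ is nearly unconditional, $\Psi(t,s)<\infty$ for all $t\ge0$ and $0<s\le1$, and $\Psi(t,s)\le\Psi(t',s')$ whenever $t\le t'$ and $s\ge s'$. Moreover, if $\mathcal{X}$ is $K$-VPQG, then $$\Psi(t,s)\le2\alpha_3+\Psi(1,s)\,(K+1)^{2+\log_2t}\qquad\text{for all } 0<s\le1 \text{ and } t>1,$$ and $$\Psi(1,s)\le C\,\alpha_1\alpha_2\alpha_3\,\frac1{s^3}\Big(K\,\phi\big(\tfrac14\big)\,\phi(s)\Big)^4\qquad\text{for all } 0<s\le1,$$ where $C>0$ is an absolute constant (independent of the field, the space, the basis, $K$ and $s$). -/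

import Mathlib

open scoped ENNReal

noncomputable section

namespace GreedyBases

/-- A basis of `X`: a sequence of vectors with dense linear span, together with its biorthogonal
sequence of continuous functionals (which is unique, by density of the span). The index set of the
basis is `ℕ = {0, 1, 2, …}`. -/
structure DualBasis (𝕜 X : Type*) [RCLike 𝕜] [NormedAddCommGroup X] [NormedSpace 𝕜 X] where
  vec : ℕ → X
  dual : ℕ → (X →L[𝕜] 𝕜)
  biorthogonal : ∀ i j, dual i (vec j) = if i = j then 1 else 0
  dense_span : Dense (Submodule.span 𝕜 (Set.range vec) : Set X)

namespace DualBasis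

variable {𝕜 X : Type*} [RCLike 𝕜] [NormedAddCommGroup X] [NormedSpace 𝕜 X]
variable (B : DualBasis 𝕜 X)

/-- `α₁ = supₙ ‖xₙ‖`. -/
def alpha1 : ℝ≥0∞ := ⨆ n, ‖B.vec n‖ₑ

/-- `α₂ = supₙ ‖xₙ*‖`. -/
def alpha2 : ℝ≥0∞ := ⨆ n, ‖B.dual n‖ₑ

/-- `α₃ = supₙ ‖xₙ‖ ‖xₙ*‖`. -/
def alpha3 : ℝ≥0∞ := ⨆ n, ‖B.vec n‖ₑ * ‖B.dual n‖ₑ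

/-- The three quantities `α₁`, `α₂`, `α₃` are finite. -/
def Seminormalized : Prop := B.alpha1 < ⊤ ∧ B.alpha2 < ⊤ ∧ B.alpha3 < ⊤

/-- The support of a vector with respect to the basis. -/
def supp (x : X) : Set ℕ := {n | B.dual n x ≠ 0}

/-- The coordinate projection `P_A` onto a finite set of indices. -/
def proj (A : Finset ℕ) (x : X) : X := ∑ n ∈ A, B.dual n x • B.vec n

/-- `A` is a greedy set for `x` of cardinality `m`. -/
def IsGreedySet (x : X) (m : ℕ) (A : Finset ℕ) : Prop :=
  A.card = m ∧ ∀ n ∈ A, ∀ k ∉ A, ‖B.dual k x‖ ≤ ‖B.dual n x‖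

/-- `k 0, k 1, k 2, …` is a greedy ordering for `x`: for each `m ≥ 1` its first `m` terms form a
greedy set for `x` of cardinality `m`. -/
def IsGreedyOrdering (x : X) (k : ℕ → ℕ) : Prop :=
  ∀ m : ℕ, 0 < m → B.IsGreedySet x m ((Finset.range m).image k)

/-- The `n`-th greedy Cesàro sum `∑_{j=1}^n ((n + 1 - j) / n) x*_{k_j}(x) x_{k_j}`. The ordering
`k` starts at `0` here, so the weight of its term of index `j` is `(n - j) / n`. -/
def cesaroSum (k : ℕ → ℕ) (n : ℕ) (x : X) : X :=
  ∑ j ∈ Finset.range n, ((((n : ℝ) - (j : ℝ)) / (n : ℝ) : ℝ) : 𝕜) • B.dual (k j) x • B.vec (k j)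

/-- `B` is `K`-de la Vallée-Poussin quasi-greedy. -/
def IsVPQGWith (K : ℝ) : Prop :=
  0 < K ∧ ∀ (x : X) (k : ℕ → ℕ) (n : ℕ), 0 < n → B.IsGreedyOrdering x k →
    ‖(2 : 𝕜) • B.cesaroSum k (2 * n) x - B.cesaroSum k n x‖ ≤ K * ‖x‖

/-- `B` is de la Vallée-Poussin quasi-greedy. -/
def IsVPQG : Prop := ∃ K : ℝ, B.IsVPQGWith K

/-- The set `Q` of vectors all of whose coordinates have modulus at most one. -/
def unitCoords : Set X := {x | ∀ n, ‖B.dual n x‖ ≤ 1}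

/-- The set `A(x, t)` of indices at which the coordinate of `x` has modulus at least `t`. -/
def levelSet (x : X) (t : ℝ) : Set ℕ := {n | t ≤ ‖B.dual n x‖}

/-- `C` is an admissible constant at the level `t` in the definition of near unconditionality. -/
def IsNearUncBound (t : ℝ) (C : ℝ≥0∞) : Prop :=
  ∀ x ∈ B.unitCoords, ∀ A : Finset ℕ, (A : Set ℕ) ⊆ B.levelSet x t →
    ‖B.proj A x‖ₑ ≤ C * ‖x‖ₑ

/-- The near unconditionality function `φ`; its value is `∞` if there is no finite constant. -/
def phi (t : ℝ) : ℝ≥0∞ := sInf {C | B.IsNearUncBound t C}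

/-- `B` is nearly unconditional. -/
def IsNearlyUnconditional : Prop :=
  ∀ t : ℝ, 0 < t → t ≤ 1 → ∃ C : ℝ, 0 < C ∧ B.IsNearUncBound t (ENNReal.ofReal C)

/-- The oscillation of `x` on a finite set: the quotient of the largest and the smallest modulus
of the coordinates of `x` there, and `1` for the empty set. -/
def osc (x : X) (A : Finset ℕ) : ℝ :=
  if h : A.Nonempty then
    A.sup' h (fun n => ‖B.dual n x‖) / A.inf' h (fun n => ‖B.dual n x‖)
  else 1

/-- The relation `x ▷ y`. -/
def Dominates (x y : X) : Prop := ∀ k ∈ B.supp x, ∀ n, ‖B.dual n y‖ ≤ ‖B.dual k x‖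

/-- `C` is an admissible constant in the definition of `Ψ(t, s)`. The finite set `S` is the support
of `y`; as it is finite, the condition `|supp x| ≤ t |supp y|` includes finiteness of `supp x`. -/
def IsPsiBound (t s : ℝ) (C : ℝ≥0∞) : Prop :=
  ∀ (x y z : X) (S : Finset ℕ) (a : ℕ → 𝕜),
    Disjoint (B.supp x) (B.supp y) → Disjoint (B.supp x) (B.supp z) →
    Disjoint (B.supp y) (B.supp z) →
    B.Dominates x y → B.Dominates y z →
    (S : Set ℕ) = B.supp y →
    (B.supp x).Finite → ((B.supp x).ncard : ℝ) ≤ t * (S.card : ℝ) →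
    B.osc y S ≤ s⁻¹ →
    (∀ j ∈ S, ‖a j‖ ≤ 1) →
    ‖∑ j ∈ S, a j • B.dual j y • B.vec j‖ₑ ≤ C * ‖x + y + z‖ₑ

/-- The threshold function `Ψ(t, s)`, with values in `[1, ∞]`: the least `C ∈ [1, ∞]` that is
admissible (see `psi_isLeast`). -/
def psi (t s : ℝ) : ℝ≥0∞ := sInf {C | 1 ≤ C ∧ B.IsPsiBound t s C}

end DualBasis

/-- The order `(t, s) ⪯ (t', s')` iff `t ≤ t'` and `s ≥ s'`. -/
def ParamLE (p q : ℝ × ℝ) : Prop := p.1 ≤ q.1 ∧ q.2 ≤ p.2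

namespace DualBasis

variable {𝕜 X : Type*} [RCLike 𝕜] [NormedAddCommGroup X] [NormedSpace 𝕜 X]
variable (B : DualBasis 𝕜 X)

theorem isNearUncBound_top (t : ℝ) : B.IsNearUncBound t ⊤ := by
  intro x _ A _
  by_cases hx : x = 0
  · simp [hx, proj]
  · rw [ENNReal.top_mul (by simpa using hx)]
    exact le_top

theorem isPsiBound_top (t s : ℝ) : B.IsPsiBound t s ⊤ := by
  intro x y z S a hxy _ hyz _ _ hS _ _ _ _
  by_cases h : x + y + z = 0
  · have hz : ∀ j ∈ S, B.dual j y = 0 := by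
      intro j hj
      have hjy : j ∈ B.supp y := by
        rw [← hS]
        exact hj
      have h1 : B.dual j x = 0 := by
        by_contra hne
        exact Set.disjoint_left.mp hxy hne hjy
      have h2 : B.dual j z = 0 := by
        by_contra hne
        exact Set.disjoint_left.mp hyz hjy hne
      have h3 := congrArg (B.dual j) h
      simpa [h1, h2] using h3
    rw [Finset.sum_eq_zero (fun j hj => by simp [hz j hj])]
    simp
  · rw [ENNReal.top_mul (by simpa using h)]
    exact le_top

theorem le_sInf_mul {s : Set ℝ≥0∞} (hs : s.Nonempty) {a b : ℝ≥0∞} (hb : b ≠ ⊤)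
    (h : ∀ C ∈ s, a ≤ C * b) : a ≤ sInf s * b := by
  rcases eq_or_ne b 0 with rfl | hb0
  · obtain ⟨C, hC⟩ := hs
    simpa using h C hC
  · rw [← ENNReal.div_le_iff hb0 hb]
    exact le_sInf fun C hC => (ENNReal.div_le_iff hb0 hb).mpr (h C hC)

/-- The infimum in the definition of `φ(t)` is a minimum. -/
theorem phi_isLeast (t : ℝ) : IsLeast {C | B.IsNearUncBound t C} (B.phi t) := by
  refine ⟨?_, fun C hC => sInf_le hC⟩
  intro x hx A hA
  exact le_sInf_mul ⟨⊤, B.isNearUncBound_top t⟩ enorm_ne_top fun C hC => hC x hx A hA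

/-- The infimum in the definition of `Ψ(t, s)` is a minimum. -/
theorem psi_isLeast (t s : ℝ) : IsLeast {C | 1 ≤ C ∧ B.IsPsiBound t s C} (B.psi t s) := by
  refine ⟨⟨le_sInf fun C hC => hC.1, ?_⟩, fun C hC => sInf_le hC⟩
  intro x y z S a h1 h2 h3 h4 h5 h6 h7 h8 h9 h10
  exact le_sInf_mul (s := {C | 1 ≤ C ∧ B.IsPsiBound t s C}) ⟨⊤, le_top, B.isPsiBound_top t s⟩ enorm_ne_top
    fun C hC => hC.2 x y z S a h1 h2 h3 h4 h5 h6 h7 h8 h9 h10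

end DualBasis

end GreedyBases

end

/-!
Write `VP_n f` for the de la Vallée-Poussin sum `2 C_{2n}(f) - C_n(f)`. In a greedy ordering its
weights are `1` up to position `n` and decrease linearly to `0` at position `2n`.

*Near unconditionality.* If `f` has finitely many coordinates of the largest modulus, greedy
orderings may list them in any order. Averaging a few orderings of two disjoint sets of `n ≥ 2` such
indices turns the weights into constants `1` and `(n + 1) / 2n`, and exchanging the sets isolates
each of them, so all coordinate projections on the flat part are bounded
(`exists_norm_proj_le_of_flat`). For coordinates of modulus in `[1 - δ, 1]`, with `δ` small, one
pushes the moduli to `1` and absorbs the error (`exists_hasNearUncConst_lt_one`). Lower levels follow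
by submultiplicativity, `φ(tu) ≤ φ(t) + φ(u) (1 + φ(t))` (`HasNearUncConst.mul`).

*Dependence on `t`.* Subtracting `VP_p f` with `p = ⌊|supp x| / 2⌋` kills more than half of the
coordinates of `x`. Others shrink, but those that end up between the smallest and the largest
modulus of `y` may be joined to `y` with multiplier `0`, and those below may be joined to `z`. Hence
`Ψ(2t, s) ≤ (K + 1) Ψ(t, s)` for `t ≥ 1` (`HasPsiConst.double`), which gives the first bound even
without the term `2 α₃`.

*The bound for `Ψ(1, s)`.* Put `M = |supp x| ≤ N = |supp y|`, `p = ⌊(M + N) / 2⌋` and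
`q = p + ⌊N / 4⌋`. The difference `VP_q f - VP_p f` vanishes on `supp x`; its weights are at most `2δ`
everywhere and at least `δ` on the positions from `q` to `2p`, where `δ = (q - p) / q ≥ 1 / 9`. Near
unconditionality at the level `s / 4` therefore controls at least the last quarter of `supp y`
(`exists_norm_sum_le_of_greedy`). Once a part `U` of `supp y` is controlled, its coordinates can all
be raised to the largest modulus on `supp y` at the cost of a factor `1 / s`. Then `U` can be listed
first in `supp y`, and a further quarter comes under control (`exists_enlarge`). Four rounds exhaust
`supp y`, which accounts for the fourth power and for `s⁻³`.
-/

noncomputable section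

namespace GreedyBases

namespace DualBasis

variable {𝕜 X : Type*} [RCLike 𝕜] [NormedAddCommGroup X] [NormedSpace 𝕜 X]
variable (B : DualBasis 𝕜 X)

/-! ### Coordinates and coordinate projections -/

theorem dual_sum_smul_vec (A : Finset ℕ) (c : ℕ → 𝕜) (n : ℕ) :
    B.dual n (∑ j ∈ A, c j • B.vec j) = if n ∈ A then c n else 0 := by
  simp [map_sum, B.biorthogonal]

theorem dual_proj (A : Finset ℕ) (x : X) (n : ℕ) :
    B.dual n (B.proj A x) = if n ∈ A then B.dual n x else 0 :=
  B.dual_sum_smul_vec A (fun j => B.dual j x) n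

theorem exists_norm_dual_le (h2 : B.alpha2 < ⊤) : ∃ c : ℝ, 0 < c ∧ ∀ n, ‖B.dual n‖ ≤ c := by
  refine ⟨B.alpha2.toReal + 1, by positivity, fun n => ?_⟩
  have h : ‖B.dual n‖ₑ ≤ B.alpha2 := le_iSup (fun n => ‖B.dual n‖ₑ) n
  have := ENNReal.toReal_mono h2.ne h
  simp only [toReal_enorm] at this
  linarith

/-- The coordinates of a vector tend to zero: they do so on the dense span of the basis, and
the coordinate functionals are uniformly bounded. -/
theorem finite_levelSet (h2 : B.alpha2 < ⊤) (x : X) {ε : ℝ} (hε : 0 < ε) :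
    (B.levelSet x ε).Finite := by
  obtain ⟨c, hc, hdual⟩ := B.exists_norm_dual_le h2
  obtain ⟨v, hxv, hv⟩ := Metric.dense_iff.1 B.dense_span x (ε / c) (by positivity)
  have hfin : (B.supp v).Finite := by
    refine Submodule.span_induction (p := fun v _ => (B.supp v).Finite) ?_ ?_ ?_ ?_ hv
    · rintro _ ⟨i, rfl⟩
      refine (Set.finite_singleton i).subset fun n hn => ?_
      by_contra hni
      exact hn (by rw [B.biorthogonal, if_neg (by simpa using hni)])
    · simp [supp]
    · intro u w _ _ hu hw
      refine (hu.union hw).subset fun n hn => ?_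
      by_contra hnot
      simp only [Set.mem_union, supp, Set.mem_ofPred_eq, not_or, not_not] at hnot
      exact hn (by rw [map_add, hnot.1, hnot.2, add_zero])
    · intro a u _ hu
      refine hu.subset fun n hn hnu => hn (by rw [map_smul, hnu, smul_zero])
  refine hfin.subset fun n hn hnv => ?_
  have hd : dist v x < ε / c := hxv
  have h1 : ‖B.dual n x‖ < ε := by
    calc ‖B.dual n x‖ = ‖B.dual n (v - x)‖ := by rw [map_sub, hnv, zero_sub, norm_neg]
      _ ≤ ‖B.dual n‖ * ‖v - x‖ := (B.dual n).le_opNorm _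
      _ ≤ c * ‖v - x‖ := by gcongr; exact hdual n
      _ < c * (ε / c) := by gcongr; rwa [← dist_eq_norm]
      _ = ε := by field_simp
  exact absurd hn (not_le.2 h1)

theorem norm_sum_smul_dual_le (h3 : B.alpha3 < ⊤) (A : Finset ℕ) (x : X) (a : ℕ → 𝕜)
    (ha : ∀ j ∈ A, ‖a j‖ ≤ 1) :
    ‖∑ j ∈ A, a j • B.dual j x • B.vec j‖ ≤ A.card * B.alpha3.toReal * ‖x‖ := by
  have h : ∀ j ∈ A, ‖a j • B.dual j x • B.vec j‖ ≤ B.alpha3.toReal * ‖x‖ := by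
    intro j hj
    have h1 : ‖B.vec j‖ₑ * ‖B.dual j‖ₑ ≤ B.alpha3 :=
      le_iSup (fun n => ‖B.vec n‖ₑ * ‖B.dual n‖ₑ) j
    have h2 := ENNReal.toReal_mono h3.ne h1
    simp only [ENNReal.toReal_mul, toReal_enorm] at h2
    rw [norm_smul, norm_smul]
    calc ‖a j‖ * (‖B.dual j x‖ * ‖B.vec j‖) ≤ 1 * ((‖B.dual j‖ * ‖x‖) * ‖B.vec j‖) := by
          gcongr
          · exact ha j hj
          · exact (B.dual j).le_opNorm x
      _ = (‖B.vec j‖ * ‖B.dual j‖) * ‖x‖ := by ring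
      _ ≤ _ := by gcongr
  calc _ ≤ ∑ j ∈ A, ‖a j • B.dual j x • B.vec j‖ := norm_sum_le _ _
    _ ≤ ∑ j ∈ A, B.alpha3.toReal * ‖x‖ := Finset.sum_le_sum h
    _ = _ := by rw [Finset.sum_const, nsmul_eq_mul, mul_assoc]

/-! ### Bounded multipliers -/

theorem norm_add_sum_unitInterval_smul_le {E : Type*} [NormedAddCommGroup E] [NormedSpace ℝ E]
    {S : Finset ℕ} {v : ℕ → E} {T : ℝ} :
    ∀ (u : E), (∀ A ⊆ S, ‖u + ∑ j ∈ A, v j‖ ≤ T) →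
    ∀ a : ℕ → ℝ, (∀ j ∈ S, 0 ≤ a j ∧ a j ≤ 1) → ‖u + ∑ j ∈ S, a j • v j‖ ≤ T := by
  induction S using Finset.induction_on with
  | empty => intro u h a _; simpa using h ∅ (by simp)
  | insert i S hi ih =>
    intro u h a ha
    obtain ⟨h0, h1⟩ := ha i (Finset.mem_insert_self i S)
    have haS : ∀ j ∈ S, 0 ≤ a j ∧ a j ≤ 1 := fun j hj => ha j (Finset.mem_insert_of_mem hj)
    have e1 := ih u (fun A hA => h A (hA.trans (Finset.subset_insert i S))) a haS
    have e2 := ih (u + v i) (fun A hA => by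
      have := h (insert i A) (Finset.insert_subset_insert i hA)
      rwa [Finset.sum_insert (fun hiA => hi (hA hiA)), ← add_assoc] at this) a haS
    have e3 : u + ∑ j ∈ insert i S, a j • v j
        = a i • (u + v i + ∑ j ∈ S, a j • v j) + (1 - a i) • (u + ∑ j ∈ S, a j • v j) := by
      rw [Finset.sum_insert hi]; module
    rw [e3]
    calc _ ≤ ‖a i • (u + v i + ∑ j ∈ S, a j • v j)‖ + ‖(1 - a i) • (u + ∑ j ∈ S, a j • v j)‖ :=
          norm_add_le _ _
      _ ≤ a i * T + (1 - a i) * T := by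
          rw [norm_smul, norm_smul, Real.norm_of_nonneg h0, Real.norm_of_nonneg (sub_nonneg.2 h1)]
          gcongr
      _ = T := by ring

theorem norm_sum_unitInterval_smul_le {S : Finset ℕ} {v : ℕ → X} {T : ℝ}
    (h : ∀ A ⊆ S, ‖∑ j ∈ A, v j‖ ≤ T) (a : ℕ → ℝ) (ha : ∀ j ∈ S, 0 ≤ a j ∧ a j ≤ 1) :
    ‖∑ j ∈ S, ((a j : ℝ) : 𝕜) • v j‖ ≤ T := by
  let _ : NormedSpace ℝ X := NormedSpace.restrictScalars ℝ 𝕜 X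
  have key := norm_add_sum_unitInterval_smul_le (S := S) (v := v) (T := T) 0 (by simpa using h) a ha
  rw [zero_add] at key
  convert key using 4 with j hj
  exact (RCLike.real_smul_eq_coe_smul (K := 𝕜) (a j) (v j)).symm

theorem norm_sum_real_smul_le {S : Finset ℕ} {v : ℕ → X} {T : ℝ}
    (h : ∀ A ⊆ S, ‖∑ j ∈ A, v j‖ ≤ T) (a : ℕ → ℝ) (ha : ∀ j ∈ S, |a j| ≤ 1) :
    ‖∑ j ∈ S, ((a j : ℝ) : 𝕜) • v j‖ ≤ 2 * T := by
  have h1 := norm_sum_unitInterval_smul_le (𝕜 := 𝕜) h (fun j => (a j)⁺) (fun j hj =>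
    ⟨posPart_nonneg _, (sup_le (le_abs_self _) (abs_nonneg _)).trans (ha j hj)⟩)
  have h2 := norm_sum_unitInterval_smul_le (𝕜 := 𝕜) h (fun j => (a j)⁻) (fun j hj =>
    ⟨negPart_nonneg _, (sup_le (neg_le_abs _) (abs_nonneg _)).trans (ha j hj)⟩)
  have e : ∑ j ∈ S, ((a j : ℝ) : 𝕜) • v j
      = ∑ j ∈ S, (((a j)⁺ : ℝ) : 𝕜) • v j - ∑ j ∈ S, (((a j)⁻ : ℝ) : 𝕜) • v j := by
    rw [← Finset.sum_sub_distrib]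
    refine Finset.sum_congr rfl fun j _ => ?_
    rw [← sub_smul, ← RCLike.ofReal_sub, posPart_sub_negPart]
  rw [e]
  linarith [norm_sub_le (∑ j ∈ S, (((a j)⁺ : ℝ) : 𝕜) • v j) (∑ j ∈ S, (((a j)⁻ : ℝ) : 𝕜) • v j)]

/-- Multipliers of modulus at most one cost at most a factor `4` over subset sums: a multiplier
with values in `[0, 1]` is a convex combination of indicator functions, and a scalar of modulus
at most one is a combination of four numbers in `[0, 1]`. -/
theorem norm_sum_smul_le {S : Finset ℕ} {v : ℕ → X} {T : ℝ}
    (h : ∀ A ⊆ S, ‖∑ j ∈ A, v j‖ ≤ T) (a : ℕ → 𝕜) (ha : ∀ j ∈ S, ‖a j‖ ≤ 1) :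
    ‖∑ j ∈ S, a j • v j‖ ≤ 4 * T := by
  have h1 := norm_sum_real_smul_le (𝕜 := 𝕜) h (fun j => RCLike.re (a j)) (fun j hj =>
    (RCLike.abs_re_le_norm _).trans (ha j hj))
  have h2 := norm_sum_real_smul_le (𝕜 := 𝕜) h (fun j => RCLike.im (a j)) (fun j hj =>
    (RCLike.abs_im_le_norm _).trans (ha j hj))
  have e : ∑ j ∈ S, a j • v j = ∑ j ∈ S, ((RCLike.re (a j) : ℝ) : 𝕜) • v j
      + (RCLike.I : 𝕜) • ∑ j ∈ S, ((RCLike.im (a j) : ℝ) : 𝕜) • v j := by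
    rw [Finset.smul_sum, ← Finset.sum_add_distrib]
    refine Finset.sum_congr rfl fun j _ => ?_
    rw [smul_smul, ← add_smul, mul_comm (RCLike.I : 𝕜), RCLike.re_add_im]
  rw [e]
  have h3 : ‖(RCLike.I : 𝕜) • ∑ j ∈ S, ((RCLike.im (a j) : ℝ) : 𝕜) • v j‖ ≤ 2 * T := by
    rw [norm_smul]
    have hI : ‖(RCLike.I : 𝕜)‖ ≤ 1 := by
      rw [RCLike.norm_I]; split_ifs <;> norm_num
    calc _ ≤ 1 * ‖∑ j ∈ S, ((RCLike.im (a j) : ℝ) : 𝕜) • v j‖ := by gcongr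
      _ ≤ 2 * T := by rw [one_mul]; exact h2
  exact (norm_add_le _ _).trans (by linarith)

/-! ### Greedy orderings -/

/-- Greedy enumeration of `ℕ` along a nonnegative weight that tends to zero. -/
theorem exists_enumeration (w : ℕ → ℝ) (hw0 : ∀ n, 0 ≤ w n)
    (hw : ∀ ε : ℝ, 0 < ε → {n | ε ≤ w n}.Finite) :
    ∃ k : ℕ → ℕ, ∀ m, ((Finset.range m).image k).card = m ∧
      ∀ i ∈ (Finset.range m).image k, ∀ l ∉ (Finset.range m).image k, w l ≤ w i := by
  have hpick : ∀ F : Finset ℕ, ∃ n, n ∉ F ∧ ∀ l ∉ F, w l ≤ w n := by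
    intro F
    by_cases h : ∃ n, n ∉ F ∧ 0 < w n
    · obtain ⟨n, hnF, hn⟩ := h
      have hfin := hw (w n) hn
      let D := hfin.toFinset \ F
      have hnD : n ∈ D := by simp [D, hnF]
      obtain ⟨i, hiD, hi⟩ := D.exists_max_image w ⟨n, hnD⟩
      refine ⟨i, (Finset.mem_sdiff.1 hiD).2, fun l hl => ?_⟩
      by_cases hln : w n ≤ w l
      · exact hi l (by simp [D, hl, hln])
      · exact (not_le.1 hln).le.trans (hi n hnD)
    · push Not at h
      obtain ⟨n, hn⟩ := Infinite.exists_notMem_finset F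
      exact ⟨n, hn, fun l hl => (h l hl).trans (hw0 n)⟩
  choose pick hpick1 hpick2 using hpick
  let F : ℕ → Finset ℕ := fun m => Nat.rec ∅ (fun _ G => insert (pick G) G) m
  have hF : ∀ m, F (m + 1) = insert (pick (F m)) (F m) := fun m => rfl
  have hFk : ∀ m, (Finset.range m).image (fun j => pick (F j)) = F m := by
    intro m
    induction m with
    | zero => rfl
    | succ m ih => rw [Finset.range_add_one, Finset.image_insert, ih, hF]
  refine ⟨fun j => pick (F j), fun m => ?_⟩
  rw [hFk]
  induction m with
  | zero => exact ⟨rfl, by simp [F]⟩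
  | succ m ih =>
    rw [hF]
    refine ⟨by rw [Finset.card_insert_of_notMem (hpick1 _), ih.1], fun i hi l hl => ?_⟩
    rw [Finset.mem_insert, not_or] at hl
    rcases Finset.mem_insert.1 hi with rfl | hi
    · exact hpick2 _ l hl.2
    · exact ih.2 i hi l hl.2

/-- The coordinates of `x` on `A` dominate in modulus those off `A`. -/
def IsGreedy (x : X) (A : Finset ℕ) : Prop := ∀ n ∈ A, ∀ k ∉ A, ‖B.dual k x‖ ≤ ‖B.dual n x‖

/-- Every finite chain of greedy sets consists of initial segments of some greedy ordering:
one orders by `|x*ₙ(x)|` plus the number of members of the chain to which `n` belongs. -/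
theorem exists_isGreedyOrdering (h2 : B.alpha2 < ⊤) (x : X) (𝓑 : Finset (Finset ℕ))
    (hchain : ∀ A ∈ 𝓑, ∀ A' ∈ 𝓑, A ⊆ A' ∨ A' ⊆ A) (hgreedy : ∀ A ∈ 𝓑, B.IsGreedy x A) :
    ∃ k : ℕ → ℕ, B.IsGreedyOrdering x k ∧
      ∀ A ∈ 𝓑, (Finset.range A.card).image k = A := by
  let r : ℕ → ℝ := fun n => ∑ A ∈ 𝓑, if n ∈ A then 1 else 0
  have hr0 : ∀ n, 0 ≤ r n := fun n => Finset.sum_nonneg fun A _ => by split_ifs <;> norm_num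
  obtain ⟨k, hk⟩ := exists_enumeration (fun n => ‖B.dual n x‖ + r n)
    (fun n => add_nonneg (norm_nonneg _) (hr0 n)) (fun ε hε => by
      refine ((B.finite_levelSet h2 x hε).union (𝓑.biUnion id).finite_toSet).subset fun n hn => ?_
      by_cases hn' : n ∈ 𝓑.biUnion id
      · exact Or.inr hn'
      · left
        have : r n = 0 := Finset.sum_eq_zero fun A hA => if_neg fun h =>
          hn' (Finset.mem_biUnion.2 ⟨A, hA, h⟩)
        simpa [levelSet, this] using hn)
  refine ⟨k, fun m _ => ⟨(hk m).1, fun n hn l hl => ?_⟩, fun A hA => ?_⟩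
  · by_contra hlt
    push Not at hlt
    have h1 := (hk m).2 n hn l hl
    have h3 : r n ≤ r l := Finset.sum_le_sum fun A hA => by
      by_cases hnA : n ∈ A
      · have hlA : l ∈ A := by
          by_contra hlA
          exact absurd (hgreedy A hA n hnA l hlA) (not_le.2 hlt)
        simp [hnA, hlA]
      · rw [if_neg hnA]; split_ifs <;> norm_num
    linarith
  · refine Finset.eq_of_subset_of_card_le ?_ (hk A.card).1.ge
    by_contra hsub
    obtain ⟨l, hl, hlA⟩ := Finset.not_subset.1 hsub
    obtain ⟨i, hiA, hi⟩ : ∃ i ∈ A, i ∉ (Finset.range A.card).image k := by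
      by_contra hcon
      push Not at hcon
      exact hlA (Finset.eq_of_subset_of_card_le hcon (hk A.card).1.le ▸ hl)
    have h1 := (hk A.card).2 l hl i hi
    have h3 := hgreedy A hA i hiA l hlA
    have h4 : r l < r i := by
      refine Finset.sum_lt_sum (fun A' hA' => ?_) ⟨A, hA, by simp [hiA, hlA]⟩
      rcases hchain A hA A' hA' with h | h
      · rw [if_pos (h hiA)]; split_ifs <;> norm_num
      · rw [if_neg fun h' => hlA (h h')]; split_ifs <;> norm_num
    linarith

theorem IsGreedyOrdering.injective {B : DualBasis 𝕜 X} {x : X} {k : ℕ → ℕ}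
    (hk : B.IsGreedyOrdering x k) : Function.Injective k := by
  intro i j hij
  have h := (hk (max i j + 1) (Nat.succ_pos _)).1
  have hinj := Finset.card_image_iff.1 (h.trans (Finset.card_range _).symm)
  exact hinj (by simp) (by simp) hij

/-! ### De la Vallée-Poussin sums -/

/-- The weight of the term of index `j` in the `n`-th de la Vallée-Poussin sum: it is `1` up to
`j = n`, and then decreases linearly to `0` at `j = 2 * n`. -/
def vpWeight (n j : ℕ) : ℝ := max 0 (min 1 (2 - (j : ℝ) / n))

theorem vpWeight_of_le {n j : ℕ} (hn : 0 < n) (h : j ≤ n) : vpWeight n j = 1 := by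
  have h0 : (0 : ℝ) < n := by exact_mod_cast hn
  have : (j : ℝ) / n ≤ 1 := (div_le_one h0).2 (by exact_mod_cast h)
  rw [vpWeight, min_eq_left (by linarith), max_eq_right zero_le_one]

theorem vpWeight_of_mem {n j : ℕ} (hn : 0 < n) (h : n ≤ j) (h' : j ≤ 2 * n) :
    vpWeight n j = 2 - (j : ℝ) / n := by
  have h0 : (0 : ℝ) < n := by exact_mod_cast hn
  have h1 : 1 ≤ (j : ℝ) / n := (one_le_div h0).2 (by exact_mod_cast h)
  have h3 : (j : ℝ) / n ≤ 2 := (div_le_iff₀ h0).2 (by exact_mod_cast h')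
  rw [vpWeight, min_eq_right (by linarith), max_eq_right (by linarith)]

theorem vpWeight_of_ge {n j : ℕ} (hn : 0 < n) (h : 2 * n ≤ j) : vpWeight n j = 0 := by
  have h0 : (0 : ℝ) < n := by exact_mod_cast hn
  have h1 : 2 ≤ (j : ℝ) / n := (le_div_iff₀ h0).2 (by exact_mod_cast h)
  rw [vpWeight, max_eq_left]
  exact (min_le_right _ _).trans (by linarith)

theorem vpWeight_nonneg (n j : ℕ) : 0 ≤ vpWeight n j := le_max_left _ _

/-- The sum of the first `m` terms of the expansion of `x` in the order `k`, with weights `w`. -/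
def weightedSum (k : ℕ → ℕ) (w : ℕ → ℝ) (m : ℕ) (x : X) : X :=
  ∑ j ∈ Finset.range m, ((w j : ℝ) : 𝕜) • B.dual (k j) x • B.vec (k j)

theorem two_smul_cesaroSum_sub (k : ℕ → ℕ) {n m : ℕ} (hn : 0 < n) (hm : 2 * n ≤ m) (x : X) :
    (2 : 𝕜) • B.cesaroSum k (2 * n) x - B.cesaroSum k n x
      = B.weightedSum k (vpWeight n) m x := by
  have h0 : (0 : ℝ) < n := by exact_mod_cast hn
  have e1 : B.cesaroSum k n x = ∑ j ∈ Finset.range (2 * n),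
      (((if j < n then ((n : ℝ) - j) / n else 0 : ℝ)) : 𝕜) • B.dual (k j) x • B.vec (k j) := by
    rw [cesaroSum, ← Finset.sum_subset (Finset.range_mono (by omega : n ≤ 2 * n))]
    · refine Finset.sum_congr rfl fun j hj => ?_
      rw [if_pos (Finset.mem_range.1 hj)]
    · intro j _ hj
      rw [if_neg (by simpa using hj)]; simp
  have e2 : B.weightedSum k (vpWeight n) m x
      = ∑ j ∈ Finset.range (2 * n),
        ((vpWeight n j : ℝ) : 𝕜) • B.dual (k j) x • B.vec (k j) := by
    rw [weightedSum, ← Finset.sum_subset (Finset.range_mono hm)]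
    intro j _ hj
    rw [vpWeight_of_ge hn (by simpa using hj)]; simp
  rw [e1, e2, cesaroSum, Finset.smul_sum, ← Finset.sum_sub_distrib]
  refine Finset.sum_congr rfl fun j hj => ?_
  rw [smul_smul, ← sub_smul]
  congr 1
  have hj2 : j < 2 * n := Finset.mem_range.1 hj
  rw [← RCLike.ofReal_ofNat, ← RCLike.ofReal_mul, ← RCLike.ofReal_sub]
  congr 1
  push_cast
  split_ifs with hjn
  · rw [vpWeight_of_le hn hjn.le]; field_simp; ring
  · rw [vpWeight_of_mem hn (by omega) hj2.le]; field_simp; ring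

theorem IsVPQGWith.norm_weightedSum_le {B : DualBasis 𝕜 X} {K : ℝ} (hK : B.IsVPQGWith K) {x : X}
    {k : ℕ → ℕ} (hk : B.IsGreedyOrdering x k) {n m : ℕ} (hn : 0 < n) (hm : 2 * n ≤ m) :
    ‖B.weightedSum k (vpWeight n) m x‖ ≤ K * ‖x‖ := by
  rw [← B.two_smul_cesaroSum_sub k hn hm]
  exact hK.2 x k n hn hk

theorem dual_weightedSum {k : ℕ → ℕ} (hk : Function.Injective k) (w : ℕ → ℝ) {m j : ℕ}
    (hj : j < m) (x : X) :
    B.dual (k j) (B.weightedSum k w m x) = (w j : 𝕜) * B.dual (k j) x := by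
  simp [weightedSum, map_sum, B.biorthogonal, hk.eq_iff, hj]

theorem dual_weightedSum_of_notMem {k : ℕ → ℕ} (w : ℕ → ℝ) {m n : ℕ}
    (hn : n ∉ (Finset.range m).image k) (x : X) :
    B.dual n (B.weightedSum k w m x) = 0 := by
  rw [weightedSum, map_sum]
  refine Finset.sum_eq_zero fun j hj => ?_
  have : n ≠ k j := fun h => hn (h ▸ Finset.mem_image_of_mem k hj)
  simp [B.biorthogonal, this]

/-- A basis with the constant `K` has `K ≥ 1`, since the first sum of `x₀` is `x₀` itself. -/
theorem IsVPQGWith.one_le {B : DualBasis 𝕜 X} {K : ℝ} (hK : B.IsVPQGWith K)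
    (h2 : B.alpha2 < ⊤) : 1 ≤ K := by
  have h00 : B.dual 0 (B.vec 0) = 1 := by simp [B.biorthogonal]
  have hne : B.vec 0 ≠ 0 := fun h => by simp [h] at h00
  obtain ⟨k, hk, hkA⟩ := B.exists_isGreedyOrdering h2 (B.vec 0) {{0}} (by simp) (by
    intro A hA n hn l hl
    obtain rfl : A = {0} := by simpa using hA
    obtain rfl : n = 0 := by simpa using hn
    have : l ≠ 0 := by simpa using hl
    simp [B.biorthogonal, this])
  have hk0 : k 0 = 0 := by
    have := hkA {0} (by simp)
    simpa using this
  have hk1 : k 1 ≠ 0 := fun h => by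
    have := hk.injective (h.trans hk0.symm)
    omega
  have h := hK.norm_weightedSum_le hk one_pos le_rfl
  have e : B.weightedSum k (vpWeight 1) (2 * 1) (B.vec 0) = B.vec 0 := by
    simp [weightedSum, Finset.sum_range_succ, hk0, B.biorthogonal, hk1,
      vpWeight_of_le one_pos (Nat.zero_le 1)]
  rw [e] at h
  have hpos : 0 < ‖B.vec 0‖ := norm_pos_iff.2 hne
  nlinarith

/-! ### Projections onto flat sets of largest coordinates -/

/-- If finitely many coordinates all have the largest modulus, they may be put at the head of a
greedy ordering in any order. -/
theorem norm_sum_vpWeight_le_of_flat {B : DualBasis 𝕜 X} {K : ℝ} (hK : B.IsVPQGWith K)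
    (h2 : B.alpha2 < ⊤) {x : X} {e : ℕ → ℕ} {n : ℕ} (hn : 0 < n)
    (he : Set.InjOn e (Finset.range (2 * n)))
    (hmax : ∀ j < 2 * n, ∀ l, ‖B.dual l x‖ ≤ ‖B.dual (e j) x‖) :
    ‖∑ j ∈ Finset.range (2 * n), ((vpWeight n j : ℝ) : 𝕜) • B.dual (e j) x • B.vec (e j)‖
      ≤ K * ‖x‖ := by
  let pre : ℕ → Finset ℕ := fun j => (Finset.range j).image e
  have hmono : Monotone pre := fun i j hij =>
    Finset.image_subset_image (Finset.range_mono hij)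
  have hcard : ∀ j ≤ 2 * n, (pre j).card = j := fun j hj => by
    rw [Finset.card_image_of_injOn (he.mono (by simpa using hj)), Finset.card_range]
  obtain ⟨k, hk, hkA⟩ := B.exists_isGreedyOrdering h2 x ((Finset.range (2 * n + 1)).image pre)
    (by
      intro A hA A' hA'
      obtain ⟨i, _, rfl⟩ := Finset.mem_image.1 hA
      obtain ⟨j, _, rfl⟩ := Finset.mem_image.1 hA'
      exact (le_total i j).imp (fun h => hmono h) (fun h => hmono h))
    (by
      intro A hA i hi l _
      obtain ⟨j, hj, rfl⟩ := Finset.mem_image.1 hA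
      obtain ⟨j', hj', rfl⟩ := Finset.mem_image.1 hi
      exact hmax j' (by simp at hj hj'; omega) l)
  have hpre : ∀ j ≤ 2 * n, (Finset.range j).image k = pre j := fun j hj => by
    have := hkA (pre j) (Finset.mem_image_of_mem pre (by simp; omega))
    rwa [hcard j hj] at this
  have hke : ∀ j < 2 * n, k j = e j := fun j hj => by
    have h1 : k j ∈ pre (j + 1) := by
      rw [← hpre (j + 1) hj]
      exact Finset.mem_image_of_mem k (Finset.self_mem_range_succ j)
    have h2 : k j ∉ pre j := by
      rw [← hpre j hj.le]
      simp [hk.injective.eq_iff]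
    obtain ⟨i, hi, hie⟩ := Finset.mem_image.1 h1
    rcases (Nat.lt_succ_iff.1 (Finset.mem_range.1 hi)).eq_or_lt with rfl | hij
    · exact hie.symm
    · exact absurd (hie ▸ Finset.mem_image_of_mem e (Finset.mem_range.2 hij)) h2
  have h := hK.norm_weightedSum_le hk hn le_rfl
  convert h using 2
  refine Finset.sum_congr rfl fun j hj => ?_
  rw [hke j (Finset.mem_range.1 hj)]

/-- Reversing the order of the second half and averaging makes the weights constant on each
half. -/
theorem norm_two_smul_add_le_of_flat {B : DualBasis 𝕜 X} {K : ℝ} (hK : B.IsVPQGWith K)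
    (h2 : B.alpha2 < ⊤) {x : X} {e : ℕ → ℕ} {n : ℕ} (hn : 0 < n)
    (he : Set.InjOn e (Finset.range (2 * n)))
    (hmax : ∀ j < 2 * n, ∀ l, ‖B.dual l x‖ ≤ ‖B.dual (e j) x‖) :
    ‖(2 : 𝕜) • ∑ j ∈ Finset.range n, B.dual (e j) x • B.vec (e j)
      + ((((n : ℝ) + 1) / n : ℝ) : 𝕜) •
        ∑ j ∈ Finset.range n, B.dual (e (n + j)) x • B.vec (e (n + j))‖ ≤ 2 * (K * ‖x‖) := by
  have h0 : (0 : ℝ) < n := by exact_mod_cast hn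
  let ρ : ℕ → ℕ := fun j => if j < n then j else 3 * n - 1 - j
  have hρ : ∀ j < 2 * n, ρ j < 2 * n := fun j hj => by simp only [ρ]; split_ifs <;> omega
  have i1 := norm_sum_vpWeight_le_of_flat hK h2 hn he hmax
  have i2 := norm_sum_vpWeight_le_of_flat hK h2 (e := e ∘ ρ) hn (by
      intro i hi j hj hij
      have hi' : i < 2 * n := by simpa using hi
      have hj' : j < 2 * n := by simpa using hj
      have := he (by simpa using hρ i hi') (by simpa using hρ j hj') hij
      simp only [ρ] at this
      split_ifs at this <;> omega) (fun j hj => hmax _ (hρ j hj))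
  have hsplit : ∀ f : ℕ → X, ∑ j ∈ Finset.range (2 * n), f j
      = ∑ j ∈ Finset.range n, f j + ∑ j ∈ Finset.range n, f (n + j) := fun f => by
    rw [two_mul, Finset.sum_range_add]
  set v : ℕ → X := fun i => B.dual i x • B.vec i with hv
  have e1 : ∑ j ∈ Finset.range (2 * n), ((vpWeight n j : ℝ) : 𝕜) • v (e j)
      = ∑ j ∈ Finset.range n, v (e j)
        + ∑ j ∈ Finset.range n, ((vpWeight n (n + j) : ℝ) : 𝕜) • v (e (n + j)) := by
    rw [hsplit]
    congr 1
    refine Finset.sum_congr rfl fun j hj => ?_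
    rw [vpWeight_of_le hn (Finset.mem_range.1 hj).le]; simp
  have e2 : ∑ j ∈ Finset.range (2 * n), ((vpWeight n j : ℝ) : 𝕜) • v ((e ∘ ρ) j)
      = ∑ j ∈ Finset.range n, v (e j)
        + ∑ j ∈ Finset.range n, ((vpWeight n (n + (n - 1 - j)) : ℝ) : 𝕜) • v (e (n + j)) := by
    rw [hsplit]
    congr 1
    · refine Finset.sum_congr rfl fun j hj => ?_
      have hj' := Finset.mem_range.1 hj
      rw [vpWeight_of_le hn hj'.le]; simp [ρ, hj']
    · rw [← Finset.sum_range_reflect (fun j => ((vpWeight n (n + j) : ℝ) : 𝕜) •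
        v ((e ∘ ρ) (n + j)))]
      refine Finset.sum_congr rfl fun j hj => ?_
      have hj' := Finset.mem_range.1 hj
      have : ρ (n + (n - 1 - j)) = n + j := by simp only [ρ]; split_ifs <;> omega
      rw [Function.comp, this]
  have e3 : (2 : 𝕜) • ∑ j ∈ Finset.range n, v (e j)
      + ((((n : ℝ) + 1) / n : ℝ) : 𝕜) • ∑ j ∈ Finset.range n, v (e (n + j))
      = ∑ j ∈ Finset.range (2 * n), ((vpWeight n j : ℝ) : 𝕜) • v (e j)
        + ∑ j ∈ Finset.range (2 * n), ((vpWeight n j : ℝ) : 𝕜) • v ((e ∘ ρ) j) := by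
    rw [e1, e2, add_add_add_comm, two_smul]
    congr 1
    rw [Finset.smul_sum, ← Finset.sum_add_distrib]
    refine Finset.sum_congr rfl fun j hj => ?_
    have hj' := Finset.mem_range.1 hj
    rw [← add_smul, ← RCLike.ofReal_add, vpWeight_of_mem hn (by omega) (by omega),
      vpWeight_of_mem hn (by omega) (by omega)]
    congr 2
    have : ((n - 1 - j : ℕ) : ℝ) = n - 1 - j := by
      rw [Nat.cast_sub (by omega), Nat.cast_sub (by omega)]; simp
    push_cast
    rw [this]
    field_simp
    ring
  rw [e3, two_mul (K * ‖x‖)]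
  exact (norm_add_le _ _).trans (add_le_add i1 i2)

/-- Exchanging the halves gives a second bound of the same kind, and for `n ≥ 2` the resulting
two by two system can be solved for each half. -/
theorem norm_sum_range_le_of_flat {B : DualBasis 𝕜 X} {K : ℝ} (hK : B.IsVPQGWith K)
    (h2 : B.alpha2 < ⊤) {x : X} {e : ℕ → ℕ} {n : ℕ} (hn : 2 ≤ n)
    (he : Set.InjOn e (Finset.range (2 * n)))
    (hmax : ∀ j < 2 * n, ∀ l, ‖B.dual l x‖ ≤ ‖B.dual (e j) x‖) :
    ‖∑ j ∈ Finset.range n, B.dual (e j) x • B.vec (e j)‖ ≤ 4 * K * ‖x‖ := by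
  have h0 : (2 : ℝ) ≤ n := by exact_mod_cast hn
  let σ : ℕ → ℕ := fun j => if j < n then n + j else j - n
  have hσ : ∀ j < 2 * n, σ j < 2 * n := fun j hj => by simp only [σ]; split_ifs <;> omega
  have i1 := norm_two_smul_add_le_of_flat hK h2 (by omega) he hmax
  have i2 := norm_two_smul_add_le_of_flat hK h2 (e := e ∘ σ) (by omega : 0 < n) (by
      intro i hi j hj hij
      have hi' : i < 2 * n := by simpa using hi
      have hj' : j < 2 * n := by simpa using hj
      have := he (by simpa using hσ i hi') (by simpa using hσ j hj') hij
      simp only [σ] at this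
      split_ifs at this <;> omega) (fun j hj => hmax _ (hσ j hj))
  have s1 : ∑ j ∈ Finset.range n, B.dual ((e ∘ σ) j) x • B.vec ((e ∘ σ) j)
      = ∑ j ∈ Finset.range n, B.dual (e (n + j)) x • B.vec (e (n + j)) :=
    Finset.sum_congr rfl fun j hj => by simp [σ, Finset.mem_range.1 hj]
  have s2 : ∑ j ∈ Finset.range n, B.dual ((e ∘ σ) (n + j)) x • B.vec ((e ∘ σ) (n + j))
      = ∑ j ∈ Finset.range n, B.dual (e j) x • B.vec (e j) :=
    Finset.sum_congr rfl fun j hj => by simp [σ]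
  rw [s1, s2] at i2
  set P := ∑ j ∈ Finset.range n, B.dual (e j) x • B.vec (e j)
  set Q := ∑ j ∈ Finset.range n, B.dual (e (n + j)) x • B.vec (e (n + j))
  set b : ℝ := ((n : ℝ) + 1) / n with hb
  have hb0 : 0 ≤ b := by positivity
  have hb1 : b ≤ 3 / 2 := by rw [hb, div_le_div_iff₀ (by linarith) two_pos]; linarith
  have e3 : ((4 - b ^ 2 : ℝ) : 𝕜) • P
      = (2 : 𝕜) • ((2 : 𝕜) • P + (b : 𝕜) • Q) - (b : 𝕜) • ((2 : 𝕜) • Q + (b : 𝕜) • P) := by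
    push_cast
    module
  have hc : 7 / 4 ≤ 4 - b ^ 2 := by nlinarith
  have h3 : ‖((4 - b ^ 2 : ℝ) : 𝕜) • P‖ ≤ 2 * (2 * (K * ‖x‖)) + 3 / 2 * (2 * (K * ‖x‖)) := by
    rw [e3]
    refine (norm_sub_le _ _).trans ?_
    rw [norm_smul, norm_smul, RCLike.norm_ofNat, RCLike.norm_ofReal, abs_of_nonneg hb0]
    gcongr
  rw [norm_smul, RCLike.norm_ofReal, abs_of_nonneg (by linarith)] at h3
  nlinarith [norm_nonneg P]

/-- Coordinate projections are uniformly bounded on a finite set of coordinates of the largest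
modulus. -/
theorem exists_norm_proj_le_of_flat {B : DualBasis 𝕜 X} (hB : B.Seminormalized) {K : ℝ}
    (hK : B.IsVPQGWith K) : ∃ C : ℝ, 1 ≤ C ∧ ∀ (x : X) (D : Finset ℕ),
      (∀ i ∈ D, ∀ l, ‖B.dual l x‖ ≤ ‖B.dual i x‖) → ∀ A ⊆ D, ‖B.proj A x‖ ≤ C * ‖x‖ := by
  obtain ⟨-, h2, h3⟩ := hB
  set a := B.alpha3.toReal with ha
  have ha0 : 0 ≤ a := ENNReal.toReal_nonneg
  have hK1 := hK.one_le h2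
  have hsmall : ∀ (x : X) (A : Finset ℕ), ‖B.proj A x‖ ≤ A.card * a * ‖x‖ := fun x A => by
    have := B.norm_sum_smul_dual_le h3 A x (fun _ => 1) (by simp)
    simpa [proj] using this
  -- sets of at most half the size
  have hhalf : ∀ (x : X) (D : Finset ℕ), (∀ i ∈ D, ∀ l, ‖B.dual l x‖ ≤ ‖B.dual i x‖) →
      ∀ H ⊆ D, 2 * H.card ≤ D.card → ‖B.proj H x‖ ≤ (4 * K + a) * ‖x‖ := by
    intro x D hD H hH hcard
    by_cases hn : 2 ≤ H.card
    · obtain ⟨H', hH', hcard'⟩ := Finset.exists_subset_card_eq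
        (s := D \ H) (n := H.card) (by rw [Finset.card_sdiff_of_subset hH]; omega)
      set n := H.card with hn_def
      let f := (H.equivFinOfCardEq hn_def.symm).symm
      let g := (H'.equivFinOfCardEq hcard').symm
      let e : ℕ → ℕ := fun j => if h : j < n then f ⟨j, h⟩ else
        if h' : j - n < n then g ⟨j - n, h'⟩ else 0
      have hef : ∀ j (h : j < n), e j = f ⟨j, h⟩ := fun j h => by simp [e, h]
      have heg : ∀ j (h : ¬ j < n) (h' : j - n < n), e j = g ⟨j - n, h'⟩ := fun j h h' => by
        simp [e, h, h']
      have hfH : ∀ i, (f i : ℕ) ∈ H := fun i => (f i).2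
      have hgH : ∀ i, (g i : ℕ) ∈ D \ H := fun i => hH' (g i).2
      have hfg : ∀ i j, (f i : ℕ) ≠ g j := fun i j h =>
        (Finset.mem_sdiff.1 (hgH j)).2 (h ▸ hfH i)
      have hinj : Set.InjOn e (Finset.range (2 * n)) := by
        intro i hi j hj hij
        simp only [Finset.coe_range, Set.mem_Iio] at hi hj
        by_cases hin : i < n <;> by_cases hjn : j < n
        · rw [hef i hin, hef j hjn] at hij
          simpa using f.injective (Subtype.ext hij)
        · rw [hef i hin, heg j hjn (by omega)] at hij
          exact absurd hij (hfg _ _)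
        · rw [hef j hjn, heg i hin (by omega)] at hij
          exact absurd hij.symm (hfg _ _)
        · rw [heg i hin (by omega), heg j hjn (by omega)] at hij
          have := g.injective (Subtype.ext hij)
          simp only [Fin.mk.injEq] at this
          omega
      have hmax : ∀ j < 2 * n, ∀ l, ‖B.dual l x‖ ≤ ‖B.dual (e j) x‖ := by
        intro j hj
        refine hD _ ?_
        by_cases hjn : j < n
        · rw [hef j hjn]; exact hH (hfH _)
        · rw [heg j hjn (by omega)]; exact (Finset.mem_sdiff.1 (hgH _)).1
      have himg : (Finset.range n).image e = H := by
        refine Finset.eq_of_subset_of_card_le ?_ ?_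
        · intro i hi
          obtain ⟨j, hj, rfl⟩ := Finset.mem_image.1 hi
          rw [hef j (Finset.mem_range.1 hj)]; exact hfH _
        · rw [Finset.card_image_of_injOn (hinj.mono (by simp; omega)), Finset.card_range]
      have h := norm_sum_range_le_of_flat hK h2 hn hinj hmax
      rw [← Finset.sum_image (f := fun i => B.dual i x • B.vec i)
        (hinj.mono (by simp; omega)), himg] at h
      refine h.trans ?_
      gcongr
      linarith
    · refine (hsmall x H).trans ?_
      gcongr
      have : (H.card : ℝ) ≤ 1 := by exact_mod_cast (by omega : H.card ≤ 1)
      nlinarith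
  refine ⟨3 * (4 * K + a), by linarith, fun x D hD A hA => ?_⟩
  by_cases hD2 : 2 ≤ D.card
  · -- an arbitrary subset is the union of three subsets of at most half the size
    have hAD := Finset.card_le_card hA
    obtain ⟨A₁, hA₁, hc₁⟩ := Finset.exists_subset_card_eq
      (s := A) (n := min A.card (D.card / 2)) (min_le_left _ _)
    have hc₁' : (A \ A₁).card = A.card - A₁.card := Finset.card_sdiff_of_subset hA₁
    obtain ⟨A₂, hA₂, hc₂⟩ := Finset.exists_subset_card_eq
      (s := A \ A₁) (n := min (A \ A₁).card (D.card / 2)) (min_le_left _ _)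
    have hc₃ : ((A \ A₁) \ A₂).card = (A \ A₁).card - A₂.card := Finset.card_sdiff_of_subset hA₂
    have e : B.proj A x = B.proj A₁ x + (B.proj A₂ x + B.proj ((A \ A₁) \ A₂) x) := by
      simp only [proj]
      rw [add_comm (∑ n ∈ A₂, _), Finset.sum_sdiff hA₂, add_comm, Finset.sum_sdiff hA₁]
    have b1 := hhalf x D hD A₁ (hA₁.trans hA) (by omega)
    have b2 := hhalf x D hD A₂ (hA₂.trans (Finset.sdiff_subset.trans hA)) (by omega)
    have b3 := hhalf x D hD ((A \ A₁) \ A₂)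
      (Finset.sdiff_subset.trans (Finset.sdiff_subset.trans hA)) (by omega)
    rw [e]
    calc _ ≤ ‖B.proj A₁ x‖ + (‖B.proj A₂ x‖ + ‖B.proj ((A \ A₁) \ A₂) x‖) :=
          (norm_add_le _ _).trans (by gcongr; exact norm_add_le _ _)
      _ ≤ _ := by linarith
  · have hA1 : (A.card : ℝ) ≤ 1 := by
      exact_mod_cast (Finset.card_le_card hA).trans (by omega)
    refine (hsmall x A).trans (mul_le_mul_of_nonneg_right ?_ (norm_nonneg _))
    nlinarith

/-! ### Near unconditionality -/

/-- Homogeneous real form of near unconditionality at the level `t`: if all coordinates of `x`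
have modulus at most `μ`, then projections onto sets of coordinates of modulus at least `t * μ`
are bounded by `C`. -/
def HasNearUncConst (t C : ℝ) : Prop :=
  ∀ (x : X) (μ : ℝ), 0 < μ → (∀ n, ‖B.dual n x‖ ≤ μ) → ∀ A : Finset ℕ,
    (∀ n ∈ A, t * μ ≤ ‖B.dual n x‖) → ‖B.proj A x‖ ≤ C * ‖x‖

theorem HasNearUncConst.of_forall_le_one {B : DualBasis 𝕜 X} {t C : ℝ}
    (h : ∀ x : X, (∀ n, ‖B.dual n x‖ ≤ 1) → ∀ A : Finset ℕ,
      (∀ n ∈ A, t ≤ ‖B.dual n x‖) → ‖B.proj A x‖ ≤ C * ‖x‖) : B.HasNearUncConst t C := by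
  intro x μ hμ hx A hA
  have hn : ∀ n, ‖B.dual n (((μ⁻¹ : ℝ) : 𝕜) • x)‖ = μ⁻¹ * ‖B.dual n x‖ := fun n => by
    rw [map_smul, smul_eq_mul, norm_mul, RCLike.norm_ofReal, abs_of_pos (inv_pos.2 hμ)]
  have key := h (((μ⁻¹ : ℝ) : 𝕜) • x)
    (fun n => by rw [hn, inv_mul_le_iff₀ hμ, mul_one]; exact hx n) A
    (fun n hnA => by rw [hn, ← div_eq_inv_mul, le_div_iff₀ hμ]; exact hA n hnA)
  have e : B.proj A (((μ⁻¹ : ℝ) : 𝕜) • x) = ((μ⁻¹ : ℝ) : 𝕜) • B.proj A x := by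
    simp only [proj, map_smul, Finset.smul_sum, smul_assoc]
  rw [e, norm_smul, norm_smul, RCLike.norm_ofReal, abs_of_pos (inv_pos.2 hμ), mul_left_comm] at key
  exact le_of_mul_le_mul_left key (inv_pos.2 hμ)

theorem HasNearUncConst.mono {B : DualBasis 𝕜 X} {t u C : ℝ} (h : B.HasNearUncConst t C)
    (htu : t ≤ u) : B.HasNearUncConst u C := fun x μ hμ hx A hA =>
  h x μ hμ hx A fun n hn => (mul_le_mul_of_nonneg_right htu hμ.le).trans (hA n hn)

/-- Submultiplicativity: first the coordinates of modulus at least `t` are removed, and what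
remains is rescaled. -/
theorem HasNearUncConst.mul {B : DualBasis 𝕜 X} (h2 : B.alpha2 < ⊤) {t u C D : ℝ} (ht : 0 < t)
    (hD : 0 ≤ D) (h : B.HasNearUncConst t C) (h' : B.HasNearUncConst u D) :
    B.HasNearUncConst (t * u) (C + D * (1 + C)) := by
  refine .of_forall_le_one fun x hx A hA => ?_
  let L := (B.finite_levelSet h2 x ht).toFinset
  have hL : ∀ n, n ∈ L ↔ t ≤ ‖B.dual n x‖ := fun n => by simp [L, levelSet]
  have b1 := h x 1 one_pos hx L (fun n hn => by rw [mul_one]; exact (hL n).1 hn)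
  have b2 := h x 1 one_pos hx (A.filter (· ∈ L)) (fun n hn => by
    rw [mul_one]; exact (hL n).1 (Finset.mem_filter.1 hn).2)
  have hd : ∀ n, B.dual n (x - B.proj L x) = if n ∈ L then 0 else B.dual n x := fun n => by
    rw [map_sub, dual_proj]; split_ifs <;> simp
  have b3 := h' (x - B.proj L x) t ht (fun n => by
      rw [hd]
      split_ifs with hn
      · simpa using ht.le
      · exact (not_le.1 fun h => hn ((hL n).2 h)).le) (A.filter (· ∉ L)) (fun n hn => by
    rw [hd, if_neg (Finset.mem_filter.1 hn).2, mul_comm]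
    exact hA n (Finset.mem_filter.1 hn).1)
  have e : B.proj A x = B.proj (A.filter (· ∈ L)) x
      + B.proj (A.filter (· ∉ L)) (x - B.proj L x) := by
    have : B.proj (A.filter (· ∉ L)) (x - B.proj L x) = B.proj (A.filter (· ∉ L)) x :=
      Finset.sum_congr rfl fun n hn => by rw [hd, if_neg (Finset.mem_filter.1 hn).2]
    rw [this]
    exact (Finset.sum_filter_add_sum_filter_not A (· ∈ L) _).symm
  rw [e]
  calc _ ≤ C * ‖x‖ + D * ‖x - B.proj L x‖ := (norm_add_le _ _).trans (add_le_add b2 b3)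
    _ ≤ C * ‖x‖ + D * (‖x‖ + C * ‖x‖) := by
        gcongr
        exact (norm_sub_le _ _).trans (by gcongr)
    _ = _ := by ring

/-- Near unconditionality at some level below `1`: replacing the coordinates of modulus at least
`1 - δ` by unimodular ones gives a vector `f` that is flat there, and the perturbation is at most
half of `‖f‖` if `δ` is small. -/
theorem exists_hasNearUncConst_lt_one {B : DualBasis 𝕜 X} (hB : B.Seminormalized) {K : ℝ}
    (hK : B.IsVPQGWith K) :
    ∃ t C : ℝ, 0 < t ∧ t < 1 ∧ 0 ≤ C ∧ B.HasNearUncConst t C := by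
  obtain ⟨C, hC, hflat⟩ := exists_norm_proj_le_of_flat hB hK
  set δ : ℝ := 1 / (8 * C) with hδ
  have hδ0 : 0 < δ := by positivity
  have hδC : δ * (4 * C) = 1 / 2 := by rw [hδ]; field_simp; norm_num
  have hδ1 : δ < 1 := by nlinarith
  refine ⟨1 - δ, 4 * C * 2, by linarith, by linarith, by positivity,
    .of_forall_le_one fun x hx A hA => ?_⟩
  let D := (B.finite_levelSet hB.2.1 x (by linarith : 0 < 1 - δ)).toFinset
  have hD : ∀ n, n ∈ D ↔ 1 - δ ≤ ‖B.dual n x‖ := fun n => by simp [D, levelSet]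
  have hD0 : ∀ n ∈ D, 0 < ‖B.dual n x‖ := fun n hn => by linarith [(hD n).1 hn]
  let c : ℕ → 𝕜 := fun n => ((‖B.dual n x‖⁻¹ : ℝ) : 𝕜) * B.dual n x
  have hc : ∀ n ∈ D, ‖c n‖ = 1 := fun n hn => by
    simp only [c, norm_mul, RCLike.norm_ofReal, abs_of_pos (inv_pos.2 (hD0 n hn))]
    exact inv_mul_cancel₀ (hD0 n hn).ne'
  have hcx : ∀ n ∈ D, ‖c n - B.dual n x‖ ≤ δ := fun n hn => by
    have e : c n - B.dual n x = (((1 - ‖B.dual n x‖ : ℝ)) : 𝕜) * c n := by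
      have : ((‖B.dual n x‖ : ℝ) : 𝕜) ≠ 0 := by exact_mod_cast (hD0 n hn).ne'
      simp only [c]
      push_cast
      field_simp
    rw [e, norm_mul, hc n hn, mul_one, RCLike.norm_ofReal, abs_of_nonneg (by linarith [hx n])]
    linarith [(hD n).1 hn]
  let f : X := x + ∑ n ∈ D, (c n - B.dual n x) • B.vec n
  have hf : ∀ n, B.dual n f = if n ∈ D then c n else B.dual n x := fun n => by
    simp only [f, map_add, dual_sum_smul_vec]
    split_ifs <;> simp
  have hfD : ∀ i ∈ D, ∀ l, ‖B.dual l f‖ ≤ ‖B.dual i f‖ := fun i hi l => by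
    rw [hf i, if_pos hi, hc i hi, hf l]
    split_ifs with hl
    · exact (hc l hl).le
    · exact hx l
  -- bounded multipliers act on the flat part of `f`
  have hmul : ∀ A ⊆ D, ∀ a : ℕ → 𝕜, ∀ r : ℝ, 0 < r → (∀ n ∈ A, ‖a n‖ ≤ r) →
      ‖∑ n ∈ A, a n • B.vec n‖ ≤ r * (4 * (C * ‖f‖)) := by
    intro A hAD a r hr ha
    have h := norm_sum_smul_le (S := A) (v := fun n => B.dual n f • B.vec n)
      (T := C * ‖f‖) (fun A' hA' => hflat f D hfD A' (hA'.trans hAD))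
      (fun n => ((r⁻¹ : ℝ) : 𝕜) * (a n * (c n)⁻¹)) (fun n hn => by
        rw [norm_mul, norm_mul, norm_inv, hc n (hAD hn), inv_one, mul_one, RCLike.norm_ofReal,
          abs_of_pos (inv_pos.2 hr), inv_mul_le_iff₀ hr, mul_one]
        exact ha n hn)
    have e : ∑ n ∈ A, a n • B.vec n = (r : 𝕜) • ∑ n ∈ A,
        (((r⁻¹ : ℝ) : 𝕜) * (a n * (c n)⁻¹)) • B.dual n f • B.vec n := by
      rw [Finset.smul_sum]
      refine Finset.sum_congr rfl fun n hn => ?_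
      have hcn : c n ≠ 0 := fun h => by simpa [h] using hc n (hAD hn)
      have hr' : (r : 𝕜) ≠ 0 := by exact_mod_cast hr.ne'
      rw [hf n, if_pos (hAD hn), smul_smul, smul_smul]
      congr 1
      push_cast
      field_simp
    rw [e, norm_smul, RCLike.norm_ofReal, abs_of_pos hr]
    gcongr
  have hfx : ‖f‖ ≤ 2 * ‖x‖ := by
    have h1 := hmul D subset_rfl (fun n => c n - B.dual n x) δ hδ0 hcx
    have h2 : ‖f‖ ≤ ‖x‖ + δ * (4 * (C * ‖f‖)) := (norm_add_le _ _).trans (by gcongr)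
    have h3 : δ * (4 * (C * ‖f‖)) = 1 / 2 * ‖f‖ := by rw [← hδC]; ring
    linarith
  have h1 := hmul A (fun n hn => (hD n).2 (hA n hn)) (fun n => B.dual n x) 1 one_pos
    (fun n _ => hx n)
  calc ‖B.proj A x‖ ≤ 1 * (4 * (C * ‖f‖)) := h1
    _ ≤ 1 * (4 * (C * (2 * ‖x‖))) := by gcongr
    _ = _ := by ring

theorem exists_hasNearUncConst {B : DualBasis 𝕜 X} (hB : B.Seminormalized) {K : ℝ}
    (hK : B.IsVPQGWith K) {t : ℝ} (ht : 0 < t) : ∃ C : ℝ, 0 < C ∧ B.HasNearUncConst t C := by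
  obtain ⟨u, D, hu0, hu1, hD, hu⟩ := exists_hasNearUncConst_lt_one hB hK
  have hpow : ∀ m : ℕ, ∃ C : ℝ, 0 ≤ C ∧ B.HasNearUncConst (u ^ (m + 1)) C := by
    intro m
    induction m with
    | zero => exact ⟨D, hD, by simpa using hu⟩
    | succ m ih =>
      obtain ⟨C, hC, h⟩ := ih
      exact ⟨C + D * (1 + C), by positivity, by
        rw [pow_succ]; exact h.mul hB.2.1 (by positivity) hD hu⟩
  obtain ⟨m, hm⟩ := exists_pow_lt_of_lt_one ht hu1
  obtain ⟨C, hC, h⟩ := hpow m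
  refine ⟨C + 1, by positivity, fun x μ hμ hx A hA => ?_⟩
  refine (h.mono ?_ x μ hμ hx A hA).trans (by gcongr; linarith)
  exact (pow_le_pow_of_le_one hu0.le hu1.le (Nat.le_succ m)).trans hm.le

theorem HasNearUncConst.isNearUncBound {B : DualBasis 𝕜 X} {t C : ℝ} (hC : 0 ≤ C)
    (h : B.HasNearUncConst t C) : B.IsNearUncBound t (ENNReal.ofReal C) := by
  intro x hx A hA
  have := h x 1 one_pos hx A (fun n hn => by rw [mul_one]; exact hA hn)
  rw [← ofReal_norm, ← ofReal_norm, ← ENNReal.ofReal_mul hC]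
  exact ENNReal.ofReal_le_ofReal this

theorem IsVPQGWith.isNearlyUnconditional {B : DualBasis 𝕜 X} (hB : B.Seminormalized) {K : ℝ}
    (hK : B.IsVPQGWith K) : B.IsNearlyUnconditional := by
  intro t ht _
  obtain ⟨C, hC, h⟩ := exists_hasNearUncConst hB hK ht
  exact ⟨C, hC, h.isNearUncBound hC.le⟩

theorem IsNearlyUnconditional.phi_lt_top {B : DualBasis 𝕜 X} (h : B.IsNearlyUnconditional)
    {t : ℝ} (ht : 0 < t) (ht1 : t ≤ 1) : B.phi t < ⊤ := by
  obtain ⟨C, -, hC⟩ := h t ht ht1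
  exact (sInf_le hC).trans_lt ENNReal.ofReal_lt_top

theorem hasNearUncConst_phi {t : ℝ} (h : B.phi t < ⊤) :
    B.HasNearUncConst t (B.phi t).toReal := by
  refine .of_forall_le_one fun x hx A hA => ?_
  have := (B.phi_isLeast t).1 x hx A (fun n hn => hA n hn)
  have := ENNReal.toReal_mono (ENNReal.mul_ne_top h.ne enorm_ne_top) this
  simpa using this

theorem one_le_phi {t : ℝ} (ht : t ≤ 1) : 1 ≤ B.phi t := by
  refine le_sInf fun C hC => ?_
  have h00 : B.dual 0 (B.vec 0) = 1 := by simp [B.biorthogonal]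
  have hne : B.vec 0 ≠ 0 := fun h => by simp [h] at h00
  have h := hC (B.vec 0) (fun n => by rw [B.biorthogonal]; split_ifs <;> simp) {0} (by
    simpa [levelSet, h00] using ht)
  have e : B.proj {0} (B.vec 0) = B.vec 0 := by simp [proj, h00]
  rw [e] at h
  by_contra hlt
  exact absurd h (not_le.2 (by
    calc C * ‖B.vec 0‖ₑ < 1 * ‖B.vec 0‖ₑ :=
          ENNReal.mul_lt_mul_left (by simpa using hne) enorm_ne_top (not_le.1 hlt)
      _ = _ := one_mul _))

/-! ### The threshold function in terms of a single vector -/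

/-- Real form of the condition defining `Ψ(t, s)`, stated for the sum `f = x + y + z`: the finite
sets `A` and `S` play the roles of the supports of `x` and `y`. -/
def HasPsiConst (t s C : ℝ) : Prop :=
  ∀ (f : X) (A S : Finset ℕ) (a : ℕ → 𝕜), Disjoint A S → B.IsGreedy f A → B.IsGreedy f (A ∪ S) →
    (∀ i ∈ S, B.dual i f ≠ 0) → (A.card : ℝ) ≤ t * S.card →
    (∀ i ∈ S, ∀ j ∈ S, s * ‖B.dual i f‖ ≤ ‖B.dual j f‖) → (∀ j ∈ S, ‖a j‖ ≤ 1) →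
    ‖∑ j ∈ S, a j • B.dual j f • B.vec j‖ ≤ C * ‖f‖

theorem HasPsiConst.isPsiBound {B : DualBasis 𝕜 X} {t s C : ℝ} (hs : 0 < s) (hC : 0 ≤ C)
    (h : B.HasPsiConst t s C) : B.IsPsiBound t s (ENNReal.ofReal C) := by
  intro x y z S a hxy hxz hyz dxy dyz hS hfin hcard hosc ha
  rcases S.eq_empty_or_nonempty with rfl | hne
  · simp
  have hyS : ∀ n, n ∈ S ↔ B.dual n y ≠ 0 := fun n => by
    rw [← Finset.mem_coe, hS]; rfl
  obtain ⟨i₀, hi₀⟩ := id hne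
  let A := hfin.toFinset
  have hxA : ∀ n, n ∈ A ↔ B.dual n x ≠ 0 := fun n => by simp [A, supp]
  have nxy : ∀ n, B.dual n x ≠ 0 → B.dual n y = 0 := fun n h1 => by
    by_contra h2; exact Set.disjoint_left.1 hxy h1 h2
  have nxz : ∀ n, B.dual n x ≠ 0 → B.dual n z = 0 := fun n h1 => by
    by_contra h2; exact Set.disjoint_left.1 hxz h1 h2
  have nyz : ∀ n, B.dual n y ≠ 0 → B.dual n z = 0 := fun n h1 => by
    by_contra h2; exact Set.disjoint_left.1 hyz h1 h2
  have nyx : ∀ n, B.dual n y ≠ 0 → B.dual n x = 0 := fun n h1 => by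
    by_contra h2; exact h1 (nxy n h2)
  have fA : ∀ n ∈ A, B.dual n (x + y + z) = B.dual n x := fun n hn => by
    have h1 := (hxA n).1 hn
    simp [nxy n h1, nxz n h1]
  have fS : ∀ n ∈ S, B.dual n (x + y + z) = B.dual n y := fun n hn => by
    have h1 := (hyS n).1 hn
    simp [nyx n h1, nyz n h1]
  have fo : ∀ n, n ∉ A → n ∉ S → B.dual n (x + y + z) = B.dual n z := fun n h1 h2 => by
    have h1' : B.dual n x = 0 := by by_contra h; exact h1 ((hxA n).2 h)
    have h2' : B.dual n y = 0 := by by_contra h; exact h2 ((hyS n).2 h)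
    simp [h1', h2']
  have yz : ∀ i ∈ S, ∀ n, ‖B.dual n z‖ ≤ ‖B.dual i y‖ := fun i hi n => dyz i ((hyS i).1 hi) n
  have xz : ∀ i ∈ A, ∀ n, ‖B.dual n z‖ ≤ ‖B.dual i x‖ := fun i hi n =>
    (yz i₀ hi₀ n).trans (dxy i ((hxA i).1 hi) i₀)
  have key := h (x + y + z) A S a
    (Finset.disjoint_left.2 fun n hn hn' => (hyS n).1 hn' (nxy n ((hxA n).1 hn)))
    (fun i hi l hl => by
      rw [fA i hi]
      by_cases hlS : l ∈ S
      · rw [fS l hlS]; exact dxy i ((hxA i).1 hi) l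
      · rw [fo l hl hlS]; exact xz i hi l)
    (fun i hi l hl => by
      rw [Finset.mem_union, not_or] at hl
      rw [fo l hl.1 hl.2]
      rcases Finset.mem_union.1 hi with hi | hi
      · rw [fA i hi]; exact xz i hi l
      · rw [fS i hi]; exact yz i hi l)
    (fun i hi => by rw [fS i hi]; exact (hyS i).1 hi)
    (by rwa [Set.ncard_eq_toFinset_card _ hfin] at hcard)
    (fun i hi j hj => by
      rw [fS i hi, fS j hj]
      rw [osc, dif_pos hne] at hosc
      have hpos : 0 < S.inf' hne (fun n => ‖B.dual n y‖) := by
        exact (Finset.lt_inf'_iff hne).2 fun n hn => norm_pos_iff.2 ((hyS n).1 hn)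
      rw [div_le_iff₀ hpos, ← div_eq_inv_mul, le_div_iff₀ hs] at hosc
      calc s * ‖B.dual i y‖ = ‖B.dual i y‖ * s := mul_comm _ _
        _ ≤ S.sup' hne (fun n => ‖B.dual n y‖) * s := by
            gcongr
            exact Finset.le_sup' (fun n => ‖B.dual n y‖) hi
        _ ≤ S.inf' hne (fun n => ‖B.dual n y‖) := hosc
        _ ≤ ‖B.dual j y‖ := Finset.inf'_le (fun n => ‖B.dual n y‖) hj) ha
  rw [Finset.sum_congr rfl fun j hj => by rw [fS j hj]] at key
  rw [← ofReal_norm, ← ofReal_norm, ← ENNReal.ofReal_mul hC]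
  exact ENNReal.ofReal_le_ofReal key

theorem IsPsiBound.hasPsiConst {B : DualBasis 𝕜 X} {t s : ℝ} {C : ℝ≥0∞} (hs : 0 < s)
    (hC : C < ⊤) (h : B.IsPsiBound t s C) : B.HasPsiConst t s C.toReal := by
  intro f A S a hdisj hA hAS hS hcard hosc ha
  rcases S.eq_empty_or_nonempty with rfl | hne
  · simp; positivity
  have hx := B.dual_proj A f
  have hy := B.dual_proj S f
  have hz : ∀ n, B.dual n (f - B.proj A f - B.proj S f)
      = if n ∈ A ∪ S then 0 else B.dual n f := fun n => by
    rw [map_sub, map_sub, hx, hy]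
    by_cases h1 : n ∈ A
    · simp [h1, Finset.disjoint_left.1 hdisj h1]
    · by_cases h2 : n ∈ S <;> simp [h1, h2]
  have sx : ∀ n, n ∈ B.supp (B.proj A f) → n ∈ A := fun n hn => by
    by_contra h; exact hn (by rw [hx, if_neg h])
  have sy : ∀ n, n ∈ B.supp (B.proj S f) ↔ n ∈ S := fun n => by
    constructor
    · intro hn
      by_contra h; exact hn (by rw [hy, if_neg h])
    · intro hn
      change B.dual n (B.proj S f) ≠ 0
      rw [hy, if_pos hn]; exact hS n hn
  have sz : ∀ n, n ∈ B.supp (f - B.proj A f - B.proj S f) → n ∉ A ∪ S := fun n hn h =>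
    hn (by rw [hz, if_pos h])
  have hfin : (B.supp (B.proj A f)).Finite := A.finite_toSet.subset sx
  have key := h (B.proj A f) (B.proj S f) (f - B.proj A f - B.proj S f) S a
    (Set.disjoint_left.2 fun n h1 h2 => Finset.disjoint_left.1 hdisj (sx n h1) ((sy n).1 h2))
    (Set.disjoint_left.2 fun n h1 h2 => sz n h2 (Finset.mem_union_left _ (sx n h1)))
    (Set.disjoint_left.2 fun n h1 h2 => sz n h2 (Finset.mem_union_right _ ((sy n).1 h1)))
    (fun i hi n => by
      rw [hx i, if_pos (sx i hi), hy n]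
      split_ifs with hn
      · exact hA i (sx i hi) n fun hnA => Finset.disjoint_left.1 hdisj hnA hn
      · simp)
    (fun i hi n => by
      rw [hy i, if_pos ((sy i).1 hi), hz n]
      split_ifs with hn
      · simp
      · exact hAS i (Finset.mem_union_right _ ((sy i).1 hi)) n hn)
    (Set.ext fun n => (sy n).symm) hfin
    (le_trans (by
      have : (B.supp (B.proj A f)).ncard ≤ A.card := by
        rw [← Set.ncard_coe_finset A]
        exact Set.ncard_le_ncard sx A.finite_toSet
      exact_mod_cast this) hcard)
    (by
      rw [osc, dif_pos hne]
      obtain ⟨i, hi, hi'⟩ := Finset.exists_mem_eq_sup' hne fun n => ‖B.dual n (B.proj S f)‖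
      obtain ⟨j, hj, hj'⟩ := Finset.exists_mem_eq_inf' hne fun n => ‖B.dual n (B.proj S f)‖
      rw [hi', hj', hy i, hy j, if_pos hi, if_pos hj,
        div_le_iff₀ (norm_pos_iff.2 (hS j hj)), ← div_eq_inv_mul, le_div_iff₀ hs, mul_comm]
      exact hosc i hi j hj) ha
  rw [Finset.sum_congr rfl fun j hj => by rw [hy j, if_pos hj],
    show B.proj A f + B.proj S f + (f - B.proj A f - B.proj S f) = f by abel] at key
  have := ENNReal.toReal_mono (ENNReal.mul_ne_top hC.ne enorm_ne_top) key
  simpa using this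

theorem hasPsiConst_psi {t s : ℝ} (hs : 0 < s) (h : B.psi t s < ⊤) :
    B.HasPsiConst t s (B.psi t s).toReal :=
  IsPsiBound.hasPsiConst hs h (B.psi_isLeast t s).1.2

theorem HasPsiConst.psi_le {B : DualBasis 𝕜 X} {t s C : ℝ} (hs : 0 < s) (hC : 1 ≤ C)
    (h : B.HasPsiConst t s C) : B.psi t s ≤ ENNReal.ofReal C :=
  sInf_le ⟨by simpa using hC, h.isPsiBound hs (by linarith)⟩

theorem one_le_psi (t s : ℝ) : 1 ≤ B.psi t s := (B.psi_isLeast t s).1.1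

theorem psi_mono {t s t' s' : ℝ} (hs' : 0 < s') (ht : t ≤ t') (hs : s' ≤ s) :
    B.psi t s ≤ B.psi t' s' := by
  refine sInf_le_sInf fun C hC => ⟨hC.1, ?_⟩
  intro x y z S a h1 h2 h3 h4 h5 h6 h7 h8 h9 h10
  exact hC.2 x y z S a h1 h2 h3 h4 h5 h6 h7 (h8.trans (by gcongr))
    (h9.trans (inv_anti₀ hs' hs)) h10

theorem HasPsiConst.mono {B : DualBasis 𝕜 X} {t t' s C : ℝ} (h : B.HasPsiConst t' s C)
    (ht : t ≤ t') : B.HasPsiConst t s C := fun f A S a h1 h2 h3 h4 h5 h6 h7 =>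
  h f A S a h1 h2 h3 h4 (h5.trans (by gcongr)) h6 h7

/-! ### Dependence on the size parameter -/

/-- Doubling `t` costs a factor `K + 1`. Subtracting from `f` a de la Vallée-Poussin sum living on
`A` kills more than half of the coordinates on `A` and shrinks others. The shrunken ones that fall
in the range of the moduli on `S` are joined to `S`, with multiplier zero. -/
theorem HasPsiConst.double {B : DualBasis 𝕜 X} (h2 : B.alpha2 < ⊤) {K : ℝ}
    (hK : B.IsVPQGWith K) {t s C : ℝ} (ht : 1 ≤ t) (hs : 0 < s) (hC : 0 ≤ C)
    (h : B.HasPsiConst t s C) : B.HasPsiConst (2 * t) s ((K + 1) * C) := by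
  intro f A S a hdisj hA hAS hS hcard hosc ha
  have hK0 := hK.1
  by_cases hsmall : (A.card : ℝ) ≤ t * S.card
  · refine (h f A S a hdisj hA hAS hS hsmall hosc ha).trans ?_
    gcongr
    nlinarith
  rcases S.eq_empty_or_nonempty with rfl | hne
  · simp; positivity
  have hSpos : 1 ≤ S.card := hne.card_pos
  set M := A.card with hM
  have hM2 : 2 ≤ M := by
    have h1 : (1 : ℝ) ≤ S.card := by exact_mod_cast hSpos
    have : (1 : ℝ) < M := by nlinarith
    have : 1 < M := by exact_mod_cast this
    omega
  obtain ⟨i₁, hi₁, hmin⟩ := S.exists_min_image (fun n => ‖B.dual n f‖) hne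
  obtain ⟨i₂, hi₂, hmax⟩ := S.exists_max_image (fun n => ‖B.dual n f‖) hne
  set lo := ‖B.dual i₁ f‖
  set hi := ‖B.dual i₂ f‖
  have hlo : 0 < lo := norm_pos_iff.2 (hS i₁ hi₁)
  have hnotA : ∀ n ∈ S, n ∉ A := fun n hn hnA => Finset.disjoint_left.1 hdisj hnA hn
  obtain ⟨k, hk, hkA⟩ := B.exists_isGreedyOrdering h2 f {A} (by simp)
    (fun A' hA' => by obtain rfl : A' = A := by simpa using hA'
                      exact hA)
  have hkA := hkA A (by simp)
  rw [← hM] at hkA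
  let p := M / 2
  have hp : 0 < p := by omega
  have hpM : 2 * p ≤ M := by omega
  set g := B.weightedSum k (vpWeight p) M f with hg
  have hg1 : ‖g‖ ≤ K * ‖f‖ := hK.norm_weightedSum_le hk hp hpM
  have fout : ∀ n ∉ A, B.dual n (f - g) = B.dual n f := fun n hn => by
    rw [map_sub, hg, B.dual_weightedSum_of_notMem _ (by rwa [hkA]), sub_zero]
  have fzero : ∀ j ≤ p, B.dual (k j) (f - g) = 0 := fun j hj => by
    rw [map_sub, hg, B.dual_weightedSum hk.injective _ (by omega), vpWeight_of_le hp hj]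
    simp
  let A' := A.filter fun n => hi < ‖B.dual n (f - g)‖
  let E := A.filter fun n => lo ≤ ‖B.dual n (f - g)‖ ∧ ‖B.dual n (f - g)‖ ≤ hi
  have hES : Disjoint S E := Finset.disjoint_left.2 fun n hn hnE =>
    hnotA n hn (Finset.mem_filter.1 hnE).1
  have hrange : ∀ n ∈ S ∪ E, lo ≤ ‖B.dual n (f - g)‖ ∧ ‖B.dual n (f - g)‖ ≤ hi := fun n hn => by
    rcases Finset.mem_union.1 hn with hn | hn
    · rw [fout n (hnotA n hn)]; exact ⟨hmin n hn, hmax n hn⟩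
    · exact (Finset.mem_filter.1 hn).2
  have hcard' : A'.card ≤ M - (p + 1) := by
    have hsub : A' ⊆ A \ (Finset.range (p + 1)).image k := fun n hn => by
      refine Finset.mem_sdiff.2 ⟨(Finset.mem_filter.1 hn).1, fun hnk => ?_⟩
      obtain ⟨j, hj, rfl⟩ := Finset.mem_image.1 hnk
      have := (Finset.mem_filter.1 hn).2
      rw [fzero j (by simp at hj; omega), norm_zero] at this
      exact absurd this (not_lt.2 (norm_nonneg _))
    have hsub' : (Finset.range (p + 1)).image k ⊆ A := by
      rw [← hkA]; exact Finset.image_subset_image (Finset.range_mono (by omega))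
    have := Finset.card_le_card hsub
    rwa [Finset.card_sdiff_of_subset hsub', (hk (p + 1) (by omega)).1] at this
  have key := h (f - g) A' (S ∪ E) (fun n => if n ∈ S then a n else 0)
    (Finset.disjoint_left.2 fun n hn hn' =>
      absurd (hrange n hn').2 (not_le.2 (Finset.mem_filter.1 hn).2))
    (fun i hiA l hl => by
      refine le_trans ?_ (Finset.mem_filter.1 hiA).2.le
      by_cases hlA : l ∈ A
      · by_contra hcon
        exact hl (Finset.mem_filter.2 ⟨hlA, not_le.1 hcon⟩)
      · rw [fout l hlA]
        by_cases hlS : l ∈ S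
        · exact hmax l hlS
        · exact hAS i₂ (Finset.mem_union_right _ hi₂) l (by simp [hlA, hlS]))
    (fun i hiA l hl => by
      have h1 : lo ≤ ‖B.dual i (f - g)‖ := by
        rcases Finset.mem_union.1 hiA with hi' | hi'
        · exact (hmin i₂ hi₂).trans (Finset.mem_filter.1 hi').2.le
        · exact (hrange i hi').1
      refine le_trans ?_ h1
      simp only [Finset.mem_union, not_or] at hl
      by_cases hlA : l ∈ A
      · by_contra hcon
        rcases lt_or_ge hi ‖B.dual l (f - g)‖ with h3 | h3
        · exact hl.1 (Finset.mem_filter.2 ⟨hlA, h3⟩)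
        · exact hl.2.2 (Finset.mem_filter.2 ⟨hlA, (not_le.1 hcon).le, h3⟩)
      · rw [fout l hlA]
        exact hAS i₁ (Finset.mem_union_right _ hi₁) l (by simp [hlA, hl.2.1]))
    (fun i hi' => norm_pos_iff.1 (hlo.trans_le (hrange i hi').1))
    (by
      have h1 : (2 : ℝ) * A'.card ≤ M := by exact_mod_cast (by omega : 2 * A'.card ≤ M)
      have h3 : (S.card : ℝ) ≤ (S ∪ E).card := by
        exact_mod_cast Finset.card_le_card Finset.subset_union_left
      nlinarith)
    (fun i hi' j hj' => by
      calc s * ‖B.dual i (f - g)‖ ≤ s * hi := by gcongr; exact (hrange i hi').2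
        _ ≤ lo := hosc i₂ hi₂ i₁ hi₁
        _ ≤ _ := (hrange j hj').1)
    (fun j _ => by
      split_ifs with hj
      · exact ha j hj
      · simp)
  have e : ∑ j ∈ S ∪ E, (if j ∈ S then a j else 0) • B.dual j (f - g) • B.vec j
      = ∑ j ∈ S, a j • B.dual j f • B.vec j := by
    rw [← Finset.sum_subset (Finset.subset_union_left (s₁ := S) (s₂ := E))
      (fun j _ hj => by simp [hj])]
    refine Finset.sum_congr rfl fun j hj => ?_
    rw [if_pos hj, fout j (hnotA j hj)]
  rw [e] at key
  calc _ ≤ C * ‖f - g‖ := key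
    _ ≤ C * (‖f‖ + K * ‖f‖) := by gcongr; exact (norm_sub_le _ _).trans (by gcongr)
    _ = _ := by ring

theorem HasPsiConst.two_pow {B : DualBasis 𝕜 X} (h2 : B.alpha2 < ⊤) {K : ℝ}
    (hK : B.IsVPQGWith K) {s C : ℝ} (hs : 0 < s) (hC : 0 ≤ C)
    (h : B.HasPsiConst 1 s C) (m : ℕ) : B.HasPsiConst (2 ^ m) s ((K + 1) ^ m * C) := by
  have hK0 := hK.1
  induction m with
  | zero => simpa using h
  | succ m ih =>
    have := ih.double h2 hK (one_le_pow₀ one_le_two) hs (by positivity)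
    rwa [← pow_succ', ← mul_assoc, ← pow_succ'] at this

theorem IsVPQGWith.psi_le {B : DualBasis 𝕜 X} (h2 : B.alpha2 < ⊤) {K : ℝ}
    (hK : B.IsVPQGWith K) {t s : ℝ} (ht : 1 < t) (hs : 0 < s) (hpsi : B.psi 1 s < ⊤) :
    B.psi t s ≤ B.psi 1 s * ENNReal.ofReal ((K + 1) ^ (2 + Real.logb 2 t)) := by
  have hK0 := hK.1
  have hlog : 0 < Real.logb 2 t := Real.logb_pos one_lt_two ht
  set m := ⌈Real.logb 2 t⌉₊ with hm
  have htm : t ≤ 2 ^ m := by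
    rw [← Real.rpow_natCast, ← Real.logb_le_iff_le_rpow one_lt_two (by linarith)]
    exact Nat.le_ceil _
  have hpow : (K + 1) ^ m ≤ (K + 1) ^ (2 + Real.logb 2 t) := by
    rw [← Real.rpow_natCast]
    refine Real.rpow_le_rpow_of_exponent_le (by linarith) ?_
    linarith [Nat.ceil_lt_add_one hlog.le]
  have h1 : 1 ≤ (B.psi 1 s).toReal := by
    simpa using ENNReal.toReal_mono hpsi.ne (B.one_le_psi 1 s)
  have h3 := ((B.hasPsiConst_psi hs hpsi).two_pow h2 hK hs (by positivity) m).mono htm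
  have h4 : 1 ≤ (K + 1) ^ m := one_le_pow₀ (by linarith)
  refine (h3.psi_le hs (one_le_mul_of_one_le_of_one_le h4 h1)).trans ?_
  rw [mul_comm, ENNReal.ofReal_mul (by positivity), ENNReal.ofReal_toReal hpsi.ne]
  gcongr

/-! ### The bound for `Ψ(1, s)` -/

/-- Difference of the weights of two de la Vallée-Poussin sums: it vanishes up to `p`, is at most
`2δ` everywhere and at least `δ` on `[q, 2p]`, where `δ = (q - p) / q`. -/
theorem abs_vpWeight_sub_le {p q : ℕ} (hp : 0 < p) (hpq : p ≤ q) (hq : q ≤ 2 * p) (j : ℕ) :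
    |vpWeight q j - vpWeight p j| ≤ 2 * (((q : ℝ) - p) / q) := by
  have hp0 : (0 : ℝ) < p := by exact_mod_cast hp
  have hq0 : (0 : ℝ) < q := by exact_mod_cast hp.trans_le hpq
  have hpq0 : (p : ℝ) ≤ q := by exact_mod_cast hpq
  have hδ : 0 ≤ ((q : ℝ) - p) / q := div_nonneg (by linarith) hq0.le
  have hδ' : ((q : ℝ) - p) / q = 1 - p / q := by field_simp
  rcases le_total j p with h | h
  · rw [vpWeight_of_le hp h, vpWeight_of_le (by omega) (h.trans hpq)]
    simpa using hδ
  have hj : (j : ℝ) / q ≤ (j : ℝ) / p := by gcongr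
  have hjp : (1 : ℝ) ≤ (j : ℝ) / p := (one_le_div hp0).2 (by exact_mod_cast h)
  rcases le_total j (2 * p) with h1 | h1
  · have h1' : (j : ℝ) / p ≤ 2 := (div_le_iff₀ hp0).2 (by exact_mod_cast h1)
    have e : (j : ℝ) / p - j / q = j / p * (((q : ℝ) - p) / q) := by field_simp
    rw [vpWeight_of_mem hp h h1]
    rcases le_total j q with h3 | h3
    · have h3' : (j : ℝ) / q ≤ 1 := (div_le_one hq0).2 (by exact_mod_cast h3)
      rw [vpWeight_of_le (by omega) h3, abs_of_nonneg (by linarith)]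
      nlinarith
    · rw [vpWeight_of_mem (by omega) h3 (by omega), abs_of_nonneg (by linarith)]
      nlinarith
  · rw [vpWeight_of_ge hp h1, sub_zero, abs_of_nonneg (vpWeight_nonneg _ _)]
    rcases le_total j (2 * q) with h3 | h3
    · have h4 : 2 * ((p : ℝ) / q) ≤ j / q := by
        rw [← mul_div_assoc]
        gcongr
        exact_mod_cast h1
      rw [vpWeight_of_mem (by omega) (by omega) h3, hδ']
      linarith
    · rw [vpWeight_of_ge (by omega) h3]; positivity

theorem le_vpWeight_sub {p q : ℕ} (hp : 0 < p) (hpq : p ≤ q) {j : ℕ} (hqj : q ≤ j)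
    (hj : j ≤ 2 * p) : ((q : ℝ) - p) / q ≤ vpWeight q j - vpWeight p j := by
  have hp0 : (0 : ℝ) < p := by exact_mod_cast hp
  have hq0 : (0 : ℝ) < q := by exact_mod_cast hp.trans_le hpq
  have hpq0 : (p : ℝ) ≤ q := by exact_mod_cast hpq
  have hδ : 0 ≤ ((q : ℝ) - p) / q := div_nonneg (by linarith) hq0.le
  have hjp : (1 : ℝ) ≤ (j : ℝ) / p := (one_le_div hp0).2 (by exact_mod_cast hpq.trans hqj)
  have e : (j : ℝ) / p - j / q = j / p * (((q : ℝ) - p) / q) := by field_simp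
  rw [vpWeight_of_mem hp (hpq.trans hqj) hj, vpWeight_of_mem (by omega) hqj (by omega)]
  nlinarith

/-- Control of a final segment of `S`. In a greedy ordering that runs through `A`, then `U`, then
the rest of `S`, the difference of two de la Vallée-Poussin sums kills the coordinates on `A`,
and is comparable with `f` on the last positions of `S`, at least a quarter of its size; near
unconditionality then projects onto them, or onto all of `S \ U` if that is smaller. -/
theorem exists_norm_sum_le_of_greedy {B : DualBasis 𝕜 X} (h2 : B.alpha2 < ⊤) {K : ℝ}
    (hK : B.IsVPQGWith K) {s Φ μ : ℝ} (hs : 0 < s) (hμ : 0 < μ) (hΦ0 : 0 ≤ Φ)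
    (hΦ : B.HasNearUncConst (s / 4) Φ) {f : X} {A S U : Finset ℕ} (hdisj : Disjoint A S)
    (hU : U ⊆ S) (hA : B.IsGreedy f A) (hAU : B.IsGreedy f (A ∪ U)) (hAS : B.IsGreedy f (A ∪ S))
    (hcard : A.card ≤ S.card) (hS4 : 4 ≤ S.card) (hle : ∀ n ∉ A, ‖B.dual n f‖ ≤ μ)
    (hge : ∀ n ∈ S, s * μ ≤ ‖B.dual n f‖) :
    ∃ W ⊆ S \ U, (W = S \ U ∨ S.card ≤ 4 * W.card) ∧
      ∀ a : ℕ → 𝕜, (∀ j ∈ W, ‖a j‖ ≤ 1) →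
        ‖∑ j ∈ W, a j • B.dual j f • B.vec j‖ ≤ 72 * K * Φ * ‖f‖ := by
  have hK0 := hK.1
  obtain ⟨k, hk, hkpre⟩ := B.exists_isGreedyOrdering h2 f {A, A ∪ U, A ∪ S}
    (by
      have h1 : A ⊆ A ∪ U := Finset.subset_union_left
      have h3 : A ⊆ A ∪ S := Finset.subset_union_left
      have h4 : A ∪ U ⊆ A ∪ S := Finset.union_subset_union_right hU
      simp [h1, h3, h4])
    (by
      intro D hD
      simp only [Finset.mem_insert, Finset.mem_singleton] at hD
      rcases hD with rfl | rfl | rfl <;> assumption)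
  set M := A.card with hM
  set N := S.card with hN
  have hcU : (A ∪ U).card = M + U.card :=
    Finset.card_union_of_disjoint (Finset.disjoint_of_subset_right hU hdisj)
  have hcS : (A ∪ S).card = M + N := Finset.card_union_of_disjoint hdisj
  have hUN : U.card ≤ N := Finset.card_le_card hU
  have kA : (Finset.range M).image k = A := hkpre A (by simp)
  have kU : (Finset.range (M + U.card)).image k = A ∪ U := hcU ▸ hkpre (A ∪ U) (by simp)
  have kS : (Finset.range (M + N)).image k = A ∪ S := hcS ▸ hkpre (A ∪ S) (by simp)
  have hkm : ∀ {m j : ℕ}, k j ∈ (Finset.range m).image k ↔ j < m := by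
    simp [hk.injective.eq_iff]
  have kAj : ∀ j, k j ∈ A ↔ j < M := fun j => by rw [← hkm (m := M), kA]
  have kUj : ∀ j, k j ∈ A ∪ U ↔ j < M + U.card := fun j => by rw [← hkm (m := M + U.card), kU]
  have kSj : ∀ j, k j ∈ A ∪ S ↔ j < M + N := fun j => by rw [← hkm (m := M + N), kS]
  -- `M ≤ p` makes the difference vanish on `A`, and `M + N ≤ 2 * p + 1` keeps all of `S` in the
  -- range of positions where its weights are bounded below.
  obtain ⟨p, hp⟩ : ∃ p, p = (M + N) / 2 := ⟨_, rfl⟩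
  obtain ⟨q, hq⟩ : ∃ q, q = p + N / 4 := ⟨_, rfl⟩
  have hp0 : 0 < p := by omega
  have hq0 : (0 : ℝ) < q := by exact_mod_cast (by omega : 0 < q)
  set δ : ℝ := ((q : ℝ) - p) / q with hδ
  have hδ9 : 1 / 9 ≤ δ := by
    have h1 : (q : ℝ) + 9 * p ≤ 9 * q := by exact_mod_cast (by omega : q + 9 * p ≤ 9 * q)
    rw [hδ, div_le_div_iff₀ (by norm_num) hq0]
    linarith
  have hδ0 : 0 < δ := by linarith
  let W := (Finset.Ico (max q (M + U.card)) (M + N)).image k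
  have hW : ∀ n ∈ W, ∃ j, n = k j ∧ q ≤ j ∧ M + U.card ≤ j ∧ j < M + N := fun n hn => by
    obtain ⟨j, hj, rfl⟩ := Finset.mem_image.1 hn
    rw [Finset.mem_Ico, max_le_iff] at hj
    exact ⟨j, rfl, hj.1.1, hj.1.2, hj.2⟩
  have hWS : W ⊆ S \ U := fun n hn => by
    obtain ⟨j, rfl, -, h1, h3⟩ := hW n hn
    have h4 := (kSj j).2 h3
    have h5 : k j ∉ A ∪ U := fun h => by have := (kUj j).1 h; omega
    rw [Finset.mem_union, not_or] at h5
    exact Finset.mem_sdiff.2 ⟨(Finset.mem_union.1 h4).resolve_left h5.1, h5.2⟩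
  refine ⟨W, hWS, ?_, fun a ha => ?_⟩
  · have hWc : W.card = M + N - max q (M + U.card) := by
      rw [Finset.card_image_of_injective _ hk.injective, Nat.card_Ico]
    rcases le_total q (M + U.card) with h | h
    · left
      refine Finset.eq_of_subset_of_card_le hWS ?_
      rw [Finset.card_sdiff_of_subset hU, hWc, max_eq_right h]
      omega
    · right
      rw [hWc, max_eq_left h]
      omega
  · set m := 2 * q with hm
    set g := B.weightedSum k (vpWeight q) m f - B.weightedSum k (vpWeight p) m f with hg
    have hgn : ‖g‖ ≤ 2 * K * ‖f‖ := by
      have h1 := hK.norm_weightedSum_le hk (by omega : 0 < q) hm.ge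
      have h3 := hK.norm_weightedSum_le hk hp0 (by omega : 2 * p ≤ m)
      exact (norm_sub_le _ _).trans (by linarith)
    have hgk : ∀ j < m, B.dual (k j) g
        = ((vpWeight q j - vpWeight p j : ℝ) : 𝕜) * B.dual (k j) f := fun j hj => by
      rw [hg, map_sub, B.dual_weightedSum hk.injective _ hj,
        B.dual_weightedSum hk.injective _ hj]
      push_cast
      ring
    have hgμ : ∀ n, ‖B.dual n g‖ ≤ 2 * δ * μ := by
      intro n
      by_cases hn : n ∈ (Finset.range m).image k
      · obtain ⟨j, hj, rfl⟩ := Finset.mem_image.1 hn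
        rw [hgk j (Finset.mem_range.1 hj), norm_mul, RCLike.norm_ofReal]
        by_cases hjM : j < M
        · rw [vpWeight_of_le hp0 (by omega), vpWeight_of_le (by omega) (by omega)]
          simp
          positivity
        · have h1 := hle (k j) (fun h => hjM ((kAj j).1 h))
          exact mul_le_mul (abs_vpWeight_sub_le hp0 (by omega) (by omega) j) h1
            (norm_nonneg _) (by positivity)
      · rw [hg, map_sub, B.dual_weightedSum_of_notMem _ hn, B.dual_weightedSum_of_notMem _ hn]
        simp
        positivity
    have hgW : ∀ n ∈ W, δ * ‖B.dual n f‖ ≤ ‖B.dual n g‖ := fun n hn => by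
      obtain ⟨j, rfl, h1, -, h3⟩ := hW n hn
      rw [hgk j (by omega), norm_mul, RCLike.norm_ofReal]
      gcongr
      exact (le_vpWeight_sub hp0 (by omega) h1 (by omega)).trans (le_abs_self _)
    have hfW : ∀ n ∈ W, s * μ ≤ ‖B.dual n f‖ := fun n hn =>
      hge n (Finset.mem_sdiff.1 (hWS hn)).1
    have hg0 : ∀ n ∈ W, 0 < ‖B.dual n g‖ := fun n hn => by
      have := hfW n hn
      have h1 : 0 < s * μ := by positivity
      exact (mul_pos hδ0 (h1.trans_le this)).trans_le (hgW n hn)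
    -- after normalization by `2δμ` the coordinates of `g` on `W` have modulus at least `s / 2`
    have hproj : ∀ D ⊆ W, ‖∑ n ∈ D, B.dual n g • B.vec n‖ ≤ Φ * (2 * K * ‖f‖) := fun D hD => by
      refine (hΦ g (2 * δ * μ) (by positivity) hgμ D fun n hn => ?_).trans (by gcongr)
      refine le_trans ?_ (hgW n (hD hn))
      have h1 := hfW n (hD hn)
      have h3 : 0 < δ * (s * μ) := by positivity
      calc s / 4 * (2 * δ * μ) = δ * (s * μ) / 2 := by ring
        _ ≤ δ * (s * μ) := by linarith
        _ ≤ δ * ‖B.dual n f‖ := by gcongr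
    -- the weights of `g` are removed by a multiplier
    have h := norm_sum_smul_le hproj (fun n => (δ : 𝕜) * (a n * B.dual n f) / B.dual n g)
      (fun n hn => by
        rw [norm_div, norm_mul, norm_mul, RCLike.norm_ofReal, abs_of_pos hδ0,
          div_le_one (hg0 n hn)]
        refine le_trans ?_ (hgW n hn)
        gcongr
        exact mul_le_of_le_one_left (norm_nonneg _) (ha n hn))
    have e : ∑ n ∈ W, ((δ : 𝕜) * (a n * B.dual n f) / B.dual n g) • B.dual n g • B.vec n
        = (δ : 𝕜) • ∑ n ∈ W, a n • B.dual n f • B.vec n := by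
      rw [Finset.smul_sum]
      refine Finset.sum_congr rfl fun n hn => ?_
      have : B.dual n g ≠ 0 := norm_pos_iff.1 (hg0 n hn)
      rw [smul_smul, smul_smul, smul_smul]
      congr 1
      field_simp
    rw [e, norm_smul, RCLike.norm_ofReal, abs_of_pos hδ0] at h
    set V := ‖∑ n ∈ W, a n • B.dual n f • B.vec n‖
    have hV : 1 / 9 * V ≤ δ * V := by gcongr
    linarith

/-- Enlarging the controlled part `U` of `S` by a quarter of `S`. The coordinates on `U` may be
replaced by the largest modulus `μ` on `S`, which allows a greedy ordering to put `U` first, so that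
the final segment reached by the previous lemma consists of new indices. -/
theorem exists_enlarge {B : DualBasis 𝕜 X} (h2 : B.alpha2 < ⊤) {K : ℝ}
    (hK : B.IsVPQGWith K) {s Φ : ℝ} (hs : 0 < s) (hΦ0 : 0 ≤ Φ)
    (hΦ : B.HasNearUncConst (s / 4) Φ) {f : X} {A S : Finset ℕ} (hdisj : Disjoint A S)
    (hA : B.IsGreedy f A) (hAS : B.IsGreedy f (A ∪ S)) (hS : ∀ i ∈ S, B.dual i f ≠ 0)
    (hosc : ∀ i ∈ S, ∀ j ∈ S, s * ‖B.dual i f‖ ≤ ‖B.dual j f‖)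
    (hcard : A.card ≤ S.card) (hS4 : 4 ≤ S.card) {U : Finset ℕ} (hU : U ⊆ S) {T : ℝ}
    (hT : ∀ a : ℕ → 𝕜, (∀ j ∈ U, ‖a j‖ ≤ 1) →
      ‖∑ j ∈ U, a j • B.dual j f • B.vec j‖ ≤ T * ‖f‖) :
    ∃ U' ⊆ S, (U' = S ∨ 4 * U.card + S.card ≤ 4 * U'.card) ∧
      ∀ a : ℕ → 𝕜, (∀ j ∈ U', ‖a j‖ ≤ 1) →
        ‖∑ j ∈ U', a j • B.dual j f • B.vec j‖
          ≤ (T + 72 * K * Φ * (1 + T + T / s)) * ‖f‖ := by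
  have hK0 := hK.1
  obtain ⟨i₀, hi₀, hmax⟩ := S.exists_max_image (fun n => ‖B.dual n f‖)
    (Finset.card_pos.1 (by omega))
  set μ := ‖B.dual i₀ f‖ with hμ_def
  have hμ : 0 < μ := norm_pos_iff.2 (hS i₀ hi₀)
  have hnotA : ∀ n ∈ S, n ∉ A := fun n hn hnA => Finset.disjoint_left.1 hdisj hnA hn
  have hout : ∀ n ∉ A, ‖B.dual n f‖ ≤ μ := fun n hn => by
    by_cases hnS : n ∈ S
    · exact hmax n hnS
    · exact hAS i₀ (Finset.mem_union_right _ hi₀) n (by simp [hn, hnS])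
  have hin : ∀ n ∈ A, μ ≤ ‖B.dual n f‖ := fun n hn => hA n hn i₀ (hnotA i₀ hi₀)
  let f' : X := f - ∑ n ∈ U, B.dual n f • B.vec n + ∑ n ∈ U, (μ : 𝕜) • B.vec n
  have hf' : ∀ n, B.dual n f' = if n ∈ U then (μ : 𝕜) else B.dual n f := fun n => by
    simp only [f', map_add, map_sub, B.dual_sum_smul_vec U (fun n => B.dual n f),
      B.dual_sum_smul_vec U (fun _ => (μ : 𝕜))]
    split_ifs <;> simp
  have hfU : ∀ n ∈ U, ‖B.dual n f'‖ = μ := fun n hn => by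
    rw [hf', if_pos hn, RCLike.norm_ofReal, abs_of_pos hμ]
  have hfnU : ∀ n ∉ U, B.dual n f' = B.dual n f := fun n hn => by rw [hf', if_neg hn]
  have hAU : ∀ n ∈ A, n ∉ U := fun n hn hnU => hnotA n (hU hnU) hn
  have hle' : ∀ n ∉ A, ‖B.dual n f'‖ ≤ μ := fun n hn => by
    by_cases hnU : n ∈ U
    · exact (hfU n hnU).le
    · rw [hfnU n hnU]; exact hout n hn
  have hin' : ∀ n ∈ A, μ ≤ ‖B.dual n f'‖ := fun n hn => by
    rw [hfnU n (hAU n hn)]; exact hin n hn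
  obtain ⟨W, hW, hWcard, hWb⟩ := exists_norm_sum_le_of_greedy h2 hK hs hμ hΦ0 hΦ hdisj hU
    (f := f') (fun n hn l hl => (hle' l hl).trans (hin' n hn))
    (fun n hn l hl => by
      rw [Finset.mem_union, not_or] at hl
      refine (hle' l hl.1).trans ?_
      rcases Finset.mem_union.1 hn with hn | hn
      · exact hin' n hn
      · exact (hfU n hn).ge)
    (fun n hn l hl => by
      have hlU : l ∉ U := fun h => hl (Finset.mem_union_right _ (hU h))
      by_cases hnU : n ∈ U
      · rw [hfU n hnU]; exact hle' l fun h => hl (Finset.mem_union_left _ h)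
      · rw [hfnU n hnU, hfnU l hlU]; exact hAS n hn l hl)
    hcard hS4 hle' (fun n hn => by
      by_cases hnU : n ∈ U
      · rw [hfU n hnU]
        have := hosc i₀ hi₀ i₀ hi₀
        exact this
      · rw [hfnU n hnU]; exact hosc i₀ hi₀ n hn)
  have hf'n : ‖f'‖ ≤ (1 + T + T / s) * ‖f‖ := by
    have b1 := hT (fun _ => 1) (by simp)
    simp only [one_smul] at b1
    -- the multiplier `s μ / x*ₙ(f)` has modulus at most one and makes the coordinates constant
    have b2 := hT (fun n => ((s * μ : ℝ) : 𝕜) / B.dual n f) (fun n hn => by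
      rw [norm_div, RCLike.norm_ofReal, abs_of_pos (by positivity),
        div_le_one (norm_pos_iff.2 (hS n (hU hn)))]
      exact hosc i₀ hi₀ n (hU hn))
    have e : ∑ n ∈ U, (((s * μ : ℝ) : 𝕜) / B.dual n f) • B.dual n f • B.vec n
        = (s : 𝕜) • ∑ n ∈ U, (μ : 𝕜) • B.vec n := by
      rw [Finset.smul_sum]
      refine Finset.sum_congr rfl fun n hn => ?_
      have := hS n (hU hn)
      rw [smul_smul, smul_smul]
      congr 1
      push_cast
      field_simp
    rw [e, norm_smul, RCLike.norm_ofReal, abs_of_pos hs, ← le_div_iff₀' hs] at b2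
    calc ‖f'‖ ≤ ‖f‖ + T * ‖f‖ + T * ‖f‖ / s :=
          (norm_add_le _ _).trans (add_le_add ((norm_sub_le _ _).trans (by gcongr)) b2)
      _ = _ := by ring
  have hWU : Disjoint U W := Finset.disjoint_left.2 fun n hn hnW =>
    (Finset.mem_sdiff.1 (hW hnW)).2 hn
  refine ⟨U ∪ W, Finset.union_subset hU (hW.trans Finset.sdiff_subset), ?_, fun a ha => ?_⟩
  · refine hWcard.imp (fun h => by rw [h, Finset.union_sdiff_of_subset hU]) (fun h => ?_)
    rw [Finset.card_union_of_disjoint hWU]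
    omega
  · have b1 := hT a (fun j hj => ha j (Finset.mem_union_left _ hj))
    have b2 := hWb a (fun j hj => ha j (Finset.mem_union_right _ hj))
    rw [Finset.sum_congr rfl fun j hj => by
      rw [hfnU j (Finset.mem_sdiff.1 (hW hj)).2]] at b2
    rw [Finset.sum_union hWU]
    calc _ ≤ T * ‖f‖ + 72 * K * Φ * ‖f'‖ := (norm_add_le _ _).trans (add_le_add b1 b2)
      _ ≤ T * ‖f‖ + 72 * K * Φ * ((1 + T + T / s) * ‖f‖) := by gcongr
      _ = _ := by ring

/-- Four enlargements exhaust `S`. Sets with fewer than four elements are handled termwise. -/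
theorem hasPsiConst_one {B : DualBasis 𝕜 X} (hB : B.Seminormalized) {K : ℝ}
    (hK : B.IsVPQGWith K) {s Φ : ℝ} (hs : 0 < s) (hs1 : s ≤ 1) (hΦ1 : 1 ≤ Φ)
    (hα : 1 ≤ B.alpha3.toReal) (hΦ : B.HasNearUncConst (s / 4) Φ) :
    B.HasPsiConst 1 s (B.alpha3.toReal * (256 * (72 * K * Φ) ^ 4 / s ^ 3)) := by
  intro f A S a hdisj hA hAS hS hcard hosc ha
  have hK1 := hK.one_le hB.2.1
  have hc : A.card ≤ S.card := by
    rw [one_mul] at hcard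
    exact_mod_cast hcard
  set T₀ := 72 * K * Φ with hT₀
  have hT1 : 1 ≤ T₀ := by nlinarith
  have hs3 : s ^ 3 ≤ 1 := pow_le_one₀ hs.le hs1
  have hG : 256 ≤ 256 * T₀ ^ 4 / s ^ 3 := by
    rw [le_div_iff₀ (by positivity)]
    nlinarith [one_le_pow₀ hT1 (n := 4)]
  by_cases hS4 : 4 ≤ S.card
  · -- the start `T = s` at `U = ∅` makes the recursion `T ↦ T + T₀ (1 + T + T / s)` at most geometric
    -- with ratio `4 T₀ / s`
    have hiter : ∀ m : ℕ, ∃ U ⊆ S, (U = S ∨ m * S.card ≤ 4 * U.card) ∧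
        ∀ a : ℕ → 𝕜, (∀ j ∈ U, ‖a j‖ ≤ 1) →
          ‖∑ j ∈ U, a j • B.dual j f • B.vec j‖ ≤ (s * (4 * T₀ / s) ^ m) * ‖f‖ := by
      intro m
      induction m with
      | zero => exact ⟨∅, by simp, by simp, fun a _ => by simp; positivity⟩
      | succ m ih =>
        obtain ⟨U, hU, hUc, hUb⟩ := ih
        obtain ⟨U', hU', hUc', hUb'⟩ := exists_enlarge hB.2.1 hK hs (by linarith) hΦ hdisj hA
          hAS hS hosc hc hS4 hU hUb
        refine ⟨U', hU', ?_, fun a ha => (hUb' a ha).trans ?_⟩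
        · rcases hUc' with h | h
          · exact Or.inl h
          · rcases hUc with rfl | h'
            · have := Finset.card_le_card hU'
              omega
            · right
              rw [add_mul]
              omega
        · gcongr
          rw [← hT₀]
          set R := (4 * T₀ / s) ^ m with hR
          have hR1 : 1 ≤ R := one_le_pow₀ (by rw [one_le_div hs]; linarith)
          have e1 : s * R / s = R := by field_simp
          have e2 : s * (4 * T₀ / s) ^ (m + 1) = 4 * T₀ * R := by
            rw [pow_succ, ← hR]; field_simp
          rw [e1, e2]
          have hsR : s * R ≤ R := mul_le_of_le_one_left (by linarith) hs1
          have h1 : s * R ≤ T₀ * R := by gcongr; linarith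
          have h3 : T₀ * (s * R) ≤ T₀ * R := by gcongr
          have h4 : T₀ * 1 ≤ T₀ * R := by gcongr
          linarith
    obtain ⟨U, hU, hUc, hUb⟩ := hiter 4
    obtain rfl : U = S := hUc.elim id fun h => Finset.eq_of_subset_of_card_le hU (by omega)
    refine (hUb a ha).trans ?_
    refine mul_le_mul_of_nonneg_right ?_ (norm_nonneg _)
    have e : s * (4 * T₀ / s) ^ 4 = 256 * T₀ ^ 4 / s ^ 3 := by field_simp; norm_num
    rw [e]
    exact le_mul_of_one_le_left (by linarith) hα
  · refine (B.norm_sum_smul_dual_le hB.2.2 S f a ha).trans ?_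
    gcongr ?_ * _
    rw [mul_comm]
    gcongr
    have : (S.card : ℝ) ≤ 3 := by exact_mod_cast (by omega : S.card ≤ 3)
    linarith

theorem one_le_enorm_mul (n : ℕ) : 1 ≤ ‖B.vec n‖ₑ * ‖B.dual n‖ₑ := by
  have h : ‖B.dual n (B.vec n)‖ₑ ≤ ‖B.dual n‖ₑ * ‖B.vec n‖ₑ := (B.dual n).le_opENorm _
  rw [B.biorthogonal, if_pos rfl, enorm_one] at h
  rwa [mul_comm]

theorem one_le_alpha3 : 1 ≤ B.alpha3 :=
  (B.one_le_enorm_mul 0).trans (le_iSup (fun n => ‖B.vec n‖ₑ * ‖B.dual n‖ₑ) 0)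

theorem one_le_alpha1_mul_alpha2 : 1 ≤ B.alpha1 * B.alpha2 :=
  (B.one_le_enorm_mul 0).trans
    (mul_le_mul' (le_iSup (fun n => ‖B.vec n‖ₑ) 0) (le_iSup (fun n => ‖B.dual n‖ₑ) 0))

theorem IsVPQGWith.psi_one_le {B : DualBasis 𝕜 X} (hB : B.Seminormalized) {K : ℝ}
    (hK : B.IsVPQGWith K) {s : ℝ} (hs : 0 < s) (hs1 : s ≤ 1) :
    B.psi 1 s ≤ ENNReal.ofReal (256 * 216 ^ 4) * B.alpha1 * B.alpha2 * B.alpha3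
      * ENNReal.ofReal (1 / s ^ 3)
      * (ENNReal.ofReal K * B.phi (1 / 4) * B.phi s) ^ 4 := by
  have hnu := hK.isNearlyUnconditional hB
  have hK1 := hK.one_le hB.2.1
  have f1 : B.phi (1 / 4) < ⊤ := hnu.phi_lt_top (by norm_num) (by norm_num)
  have f2 : B.phi s < ⊤ := hnu.phi_lt_top hs hs1
  have g1 : 1 ≤ (B.phi (1 / 4)).toReal := by
    simpa using ENNReal.toReal_mono f1.ne (B.one_le_phi (by norm_num))
  have g2 : 1 ≤ (B.phi s).toReal := by
    simpa using ENNReal.toReal_mono f2.ne (B.one_le_phi hs1)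
  have g3 : 1 ≤ B.alpha3.toReal := by
    simpa using ENNReal.toReal_mono hB.2.2.ne B.one_le_alpha3
  have hmul := (B.hasNearUncConst_phi f1).mul hB.2.1 (by norm_num) (by linarith)
    (B.hasNearUncConst_phi f2)
  rw [show 1 / 4 * s = s / 4 by ring] at hmul
  set x := (B.phi (1 / 4)).toReal with hx
  set y := (B.phi s).toReal with hy
  have hΦ : B.HasNearUncConst (s / 4) (3 * x * y) := fun z μ hμ hz A hA =>
    (hmul z μ hμ hz A hA).trans (by gcongr; nlinarith)
  have hΦ1 : 1 ≤ 3 * x * y := by nlinarith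
  have hs3 : s ^ 3 ≤ 1 := pow_le_one₀ hs.le hs1
  have hconst : 1 ≤ B.alpha3.toReal * (256 * (72 * K * (3 * x * y)) ^ 4 / s ^ 3) := by
    refine one_le_mul_of_one_le_of_one_le g3 ?_
    rw [one_le_div (by positivity)]
    have : 1 ≤ (72 * K * (3 * x * y)) ^ 4 := one_le_pow₀ (by nlinarith)
    linarith
  refine ((hasPsiConst_one hB hK hs hs1 hΦ1 g3 hΦ).psi_le hs hconst).trans ?_
  have e : ENNReal.ofReal (B.alpha3.toReal * (256 * (72 * K * (3 * x * y)) ^ 4 / s ^ 3))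
      = 1 * (ENNReal.ofReal (256 * 216 ^ 4) * B.alpha3 * ENNReal.ofReal (1 / s ^ 3)
        * (ENNReal.ofReal K * B.phi (1 / 4) * B.phi s) ^ 4) := by
    rw [← ENNReal.ofReal_toReal f1.ne, ← ENNReal.ofReal_toReal f2.ne, ← hx, ← hy,
      ← ENNReal.ofReal_mul (by linarith), ← ENNReal.ofReal_mul (by positivity),
      ← ENNReal.ofReal_pow (by positivity), one_mul]
    conv_rhs => rw [← ENNReal.ofReal_toReal hB.2.2.ne]
    rw [← ENNReal.ofReal_mul (by positivity), ← ENNReal.ofReal_mul (by positivity),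
      ← ENNReal.ofReal_mul (by positivity)]
    congr 1
    ring
  rw [e]
  calc _ ≤ (B.alpha1 * B.alpha2) * (ENNReal.ofReal (256 * 216 ^ 4) * B.alpha3
        * ENNReal.ofReal (1 / s ^ 3)
        * (ENNReal.ofReal K * B.phi (1 / 4) * B.phi s) ^ 4) := by
        gcongr
        exact B.one_le_alpha1_mul_alpha2
    _ = _ := by ring

theorem IsVPQGWith.psi_one_lt_top {B : DualBasis 𝕜 X} (hB : B.Seminormalized) {K : ℝ}
    (hK : B.IsVPQGWith K) {s : ℝ} (hs : 0 < s) (hs1 : s ≤ 1) : B.psi 1 s < ⊤ := by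
  have hnu := hK.isNearlyUnconditional hB
  have f1 : B.phi (1 / 4) < ⊤ := hnu.phi_lt_top (by norm_num) (by norm_num)
  have f2 : B.phi s < ⊤ := hnu.phi_lt_top hs hs1
  refine (hK.psi_one_le hB hs hs1).trans_lt ?_
  obtain ⟨a1, a2, a3⟩ := hB
  refine ENNReal.mul_lt_top (ENNReal.mul_lt_top (ENNReal.mul_lt_top (ENNReal.mul_lt_top
    (ENNReal.mul_lt_top ENNReal.ofReal_lt_top a1) a2) a3) ENNReal.ofReal_lt_top)
    (ENNReal.pow_lt_top (ENNReal.mul_lt_top (ENNReal.mul_lt_top ENNReal.ofReal_lt_top f1) f2))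

end DualBasis

end GreedyBases

end

theorem mainTheorem9 :
    ∃ C : ℝ, 0 < C ∧
      ∀ (𝕜 : Type*) [RCLike 𝕜] (X : Type*) [NormedAddCommGroup X] [NormedSpace 𝕜 X]
        [CompleteSpace X] (B : GreedyBases.DualBasis 𝕜 X),
        B.Seminormalized → B.IsVPQG →
        -- the near unconditionality function `φ` is finite
        B.IsNearlyUnconditional ∧
        -- `Ψ` is non-decreasing
        (∀ t s t' s' : ℝ, 0 ≤ t → 0 < s → s ≤ 1 → 0 ≤ t' → 0 < s' → s' ≤ 1 →
          GreedyBases.ParamLE (t, s) (t', s') → B.psi t s ≤ B.psi t' s') ∧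
        -- `Ψ` is finite
        (∀ t s : ℝ, 0 ≤ t → 0 < s → s ≤ 1 → B.psi t s < ⊤) ∧
        -- the explicit bounds
        (∀ K : ℝ, B.IsVPQGWith K →
          (∀ t s : ℝ, 1 < t → 0 < s → s ≤ 1 →
            B.psi t s ≤ 2 * B.alpha3
              + B.psi 1 s * ENNReal.ofReal ((K + 1) ^ (2 + Real.logb 2 t))) ∧
          (∀ s : ℝ, 0 < s → s ≤ 1 →
            B.psi 1 s ≤ ENNReal.ofReal C * B.alpha1 * B.alpha2 * B.alpha3
              * ENNReal.ofReal (1 / s ^ 3)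
              * (ENNReal.ofReal K * B.phi (1 / 4) * B.phi s) ^ 4)) := by
  refine ⟨256 * 216 ^ 4, by positivity, ?_⟩
  intro 𝕜 _ X _ _ _ B hB hV
  obtain ⟨K₀, hK₀⟩ := hV
  refine ⟨hK₀.isNearlyUnconditional hB, ?_, ?_, fun K hK => ⟨?_, ?_⟩⟩
  · intro t s t' s' _ _ _ _ hs' _ hle
    exact B.psi_mono hs' hle.1 hle.2
  · intro t s _ hs hs1
    have h1 := hK₀.psi_one_lt_top hB hs hs1
    refine (B.psi_mono hs (le_max_left t 2) le_rfl).trans_lt ?_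
    refine (hK₀.psi_le hB.2.1 (lt_max_of_lt_right one_lt_two) hs h1).trans_lt ?_
    exact ENNReal.mul_lt_top h1 ENNReal.ofReal_lt_top
  · intro t s ht hs hs1
    exact (hK.psi_le hB.2.1 ht hs (hK.psi_one_lt_top hB hs hs1)).trans le_add_self
  · intro s hs hs1
    exact hK.psi_one_le hB hs hs1
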